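/- Let $N^5_s(c)$ be a smooth $5$-dimensional pseudo-Riemannian manifold of index $s$ and constant sectional curvature $c\in\mathbb R$, that is, with curvature tensor $\tilde R(X,Y)Z=c(\langle Y,Z\rangle X-\langle X,Z\rangle Y)$. Let $M^4_r$ be a connected smooth $4$-manifold and $x:M^4_r\to N^5_s(c)$ a smooth map whose induced metric is nondegenerate of index $r$ (a nondegenerate immersed hypersurface). Let $\vec\xi$ be a smooth unit normal vector field along $x$, $\langle\vec\xi,\vec\xi\rangle=\varepsilon$ with a constant $\varepsilon\in\{1,-1\}$. Denote by $\nabla$ and $\tilde\nabla$ the Levi-Civita connections of the induced metric and of $N^5_s(c)$ (the latter also acting on vector fields along $x$), by $A$ the shape operator, $x_*(AX)=-\tilde\nabla_X\vec\xi$, by $H=\tfrac14\,\varepsilon\operatorname{tr}A$ the mean curvature, by $\vec H=H\vec\xi$ the mean curvature vector field, and by $$\Delta V=-\sum_{i=1}^4\varepsilon_i\bigl(\tilde\nabla_{e_i}\tilde\nabla_{e_i}-\tilde\nabla_{\nabla_{e_i}e_i}\bigr)V$$ the Laplace operator on vector fields $V$ along $x$, where $\{e_i\}$ is a local orthonormal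 frame of $M^4_r$, $\langle e_i,e_i\rangle=\varepsilon_i=\pm1$. Suppose that $\Delta\vec H=\lambda\vec H$ for some constant $\lambda\in\mathbb R$, and that at every point of $M^4_r$ the shape operator $A$ has exactly one (a priori complex) eigenvalue, of whatever geometric multiplicity; $A$ is not assumed to be diagonalizable. Then: * if $\varepsilon\lambda\le 0$, then $H=0$ on $M^4_r$; * if $\varepsilon\lambda>0$, then either $H=0$ on all of $M^4_r$, or $H^2=\dfrac{\varepsilon\lambda}{4}$ on all of $M^4_r$. -/

import Mathlib

open scoped Manifold ContDiff
open Bundle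

noncomputable section

namespace PseudoRiem

/-! Coordinate calculus. A metric on an open subset of `ℝⁿ` is a function `G` with values in the
bilinear forms; a map from an open subset of `ℝᵐ` is a function `F`; a vector field along `F` is a
function `V` on `ℝᵐ` with values in `ℝⁿ`. -/

/-- The Cartesian space `ℝⁿ` in which the charts take their values. -/
abbrev Coord (n : ℕ) : Type := EuclideanSpace ℝ (Fin n)

/-- Bilinear forms on `ℝⁿ`. -/
abbrev CoordForm (n : ℕ) : Type := Coord n →L[ℝ] Coord n →L[ℝ] ℝ

/-- The coordinate vector `∂ᵢ`. -/
def basisVec {n : ℕ} (i : Fin n) : Coord n := EuclideanSpace.single i (1 : ℝ)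

/-- The matrix `gᵢⱼ` of a bilinear form. -/
def gram {n : ℕ} (B : CoordForm n) : Matrix (Fin n) (Fin n) ℝ :=
  Matrix.of fun i j => B (basisVec i) (basisVec j)

/-- The Levi-Civita connection in coordinates: `Γ(u, v)` is the vector with components
`Γᵏ(u, v) = ½ gᵏˡ (∂ᵤ g(v, ∂ₗ) + ∂ᵥ g(u, ∂ₗ) - ∂ₗ g(u, v))`, so that `∇ᵤ V = ∂ᵤ V + Γ(u, V)`. -/
def christoffel {n : ℕ} (G : Coord n → CoordForm n) (y u v : Coord n) : Coord n :=
  ∑ k, ∑ l, ((gram (G y))⁻¹ k l *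
    (1 / 2 * (fderiv ℝ G y u v (basisVec l) + fderiv ℝ G y v u (basisVec l)
      - fderiv ℝ G y (basisVec l) u v))) • basisVec k

/-- The covariant derivative at `q`, in the direction `u`, of a vector field `V` along the map `F`
into a space with metric `G`; for `F = id` this is the Levi-Civita connection of `G` itself. -/
def covDeriv {m n : ℕ} (G : Coord n → CoordForm n) (F V : Coord m → Coord n) (q u : Coord m) :
    Coord n :=
  fderiv ℝ V q u + christoffel G (F q) (fderiv ℝ F q u) (V q)

/-- The curvature tensor `R(X, Y) Z = ∇_X ∇_Y Z - ∇_Y ∇_X Z - ∇_[X, Y] Z`, evaluated on the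
constant vector fields `u`, `v`, `w` (for which `[u, v] = 0`). -/
def curvature {n : ℕ} (G : Coord n → CoordForm n) (y u v w : Coord n) : Coord n :=
  covDeriv G id (fun z => covDeriv G id (fun _ => w) z v) y u
    - covDeriv G id (fun z => covDeriv G id (fun _ => w) z u) y v

/-- The second covariant derivative `∇̃ᵤ ∇̃ᵥ V - ∇̃_(∇ᵤ v) V` of a vector field `V` along `F`,
where `∇` is the Levi-Civita connection of the metric `h` of the domain, and `u`, `v` are constant
vector fields. -/
def secondCovDeriv {m n : ℕ} (h : Coord m → CoordForm m) (G : Coord n → CoordForm n)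
    (F V : Coord m → Coord n) (q u v : Coord m) : Coord n :=
  covDeriv G F (fun z => covDeriv G F V z v) q u - covDeriv G F V q (christoffel h q u v)

/-- The Laplace operator `Δ V = - hⁱʲ (∇̃ᵢ ∇̃ⱼ - ∇̃_(∇ᵢ ∂ⱼ)) V` on vector fields along `F`. -/
def laplacian {m n : ℕ} (h : Coord m → CoordForm m) (G : Coord n → CoordForm n)
    (F V : Coord m → Coord n) (q : Coord m) : Coord n :=
  - ∑ i, ∑ j, (gram (h q))⁻¹ i j • secondCovDeriv h G F V q (basisVec i) (basisVec j)

/-- The matrix `Aⁱₖ = hⁱʲ ⟨-∇̃ₖ ξ, F_* ∂ⱼ⟩` of the shape operator associated with a vector field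
`ξ` normal to the immersion `F`, whose induced metric is `h`. -/
def shapeMatrix {m n : ℕ} (h : Coord m → CoordForm m) (G : Coord n → CoordForm n)
    (F ξ : Coord m → Coord n) (q : Coord m) : Matrix (Fin m) (Fin m) ℝ :=
  Matrix.of fun i k => ∑ j, (gram (h q))⁻¹ i j *
    G (F q) (-covDeriv G F ξ q (basisVec k)) (fderiv ℝ F q (basisVec j))

/-! Manifolds. -/

section Manifolds

variable {m n : ℕ}
  {M : Type*} [TopologicalSpace M] [ChartedSpace (Coord m) M]
  {N : Type*} [TopologicalSpace N] [ChartedSpace (Coord n) N]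

/-- The quadratic form `v ↦ B(v, v)` of a bilinear form on a tangent space. -/
def quadForm {p : N} (B : TangentSpace (𝓡 n) p →L[ℝ] TangentSpace (𝓡 n) p →L[ℝ] ℝ) :
    QuadraticForm ℝ (TangentSpace (𝓡 n) p) :=
  LinearMap.BilinMap.toQuadraticMap (ContinuousLinearMap.toLinearMap₁₂ B)

variable (n N) in
/-- A smooth pseudo-Riemannian metric. -/
structure Metric [IsManifold (𝓡 n) ∞ N] where
  val : ∀ p : N, TangentSpace (𝓡 n) p →L[ℝ] TangentSpace (𝓡 n) p →L[ℝ] ℝ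
  symm : ∀ p u v, val p u v = val p v u
  nondegenerate : ∀ p u, (∀ v, val p u v = 0) → u = 0
  contMDiff : ContMDiff (𝓡 n) ((𝓡 n).prod 𝓘(ℝ, CoordForm n)) ∞
    (fun p => TotalSpace.mk' (CoordForm n) p (val p))

/-- The coordinate expression of a field of bilinear forms in the chart `ψ`. -/
def coordForm (ψ : OpenPartialHomeomorph N (Coord n))
    (g : ∀ p : N, TangentSpace (𝓡 n) p →L[ℝ] TangentSpace (𝓡 n) p →L[ℝ] ℝ)
    (y : Coord n) : CoordForm n :=
  let L : Coord n →L[ℝ] TangentSpace (𝓡 n) (ψ.symm y) := mfderiv 𝓘(ℝ, Coord n) (𝓡 n) ψ.symm y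
  (ContinuousLinearMap.precomp ℝ L).comp ((g (ψ.symm y)).comp L)

/-- The coordinate expression of a map in the charts `φ` and `ψ`. -/
def coordMap (φ : OpenPartialHomeomorph M (Coord m)) (ψ : OpenPartialHomeomorph N (Coord n))
    (x : M → N) (q : Coord m) : Coord n :=
  ψ (x (φ.symm q))

/-- The coordinate expression of a vector field along `x` in the charts `φ` and `ψ`. -/
def coordField (φ : OpenPartialHomeomorph M (Coord m)) (ψ : OpenPartialHomeomorph N (Coord n))
    (x : M → N) (V : ∀ p : M, TangentSpace (𝓡 n) (x p)) (q : Coord m) : Coord n :=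
  mfderiv (𝓡 n) 𝓘(ℝ, Coord n) ψ (x (φ.symm q)) (V (φ.symm q))

/-- The metric `x^* g` induced on `M` by a map `x : M → N`. -/
def inducedForm (g : ∀ y : N, TangentSpace (𝓡 n) y →L[ℝ] TangentSpace (𝓡 n) y →L[ℝ] ℝ)
    (x : M → N) (p : M) : TangentSpace (𝓡 m) p →L[ℝ] TangentSpace (𝓡 m) p →L[ℝ] ℝ :=
  (ContinuousLinearMap.precomp ℝ (mfderiv (𝓡 m) (𝓡 n) x p)).comp
    ((g (x p)).comp (mfderiv (𝓡 m) (𝓡 n) x p))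

variable [IsManifold (𝓡 n) ∞ N]

/-- The metric has index `s` and constant sectional curvature `c`, that is,
`R(X, Y) Z = c (⟨Y, Z⟩ X - ⟨X, Z⟩ Y)`. -/
structure IsSpaceForm (g : Metric n N) (s : ℕ) (c : ℝ) : Prop where
  index_eq : ∀ p, sigNeg (quadForm (g.val p)) = s
  curvature_eq : ∀ ψ ∈ atlas (Coord n) N, ∀ y ∈ ψ.target, ∀ u v w : Coord n,
    curvature (coordForm ψ g.val) y u v w =
      c • (coordForm ψ g.val y v w • u - coordForm ψ g.val y u w • v)

/-- `x` is a smooth map whose induced metric is nondegenerate of index `r`. In particular, `x` is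
an immersion, isometric for the induced metric. -/
structure IsNondegenerateImmersion (m : ℕ) {M : Type*} [TopologicalSpace M]
    [ChartedSpace (Coord m) M] (g : Metric n N) (x : M → N) (r : ℕ) : Prop where
  contMDiff : ContMDiff (𝓡 m) (𝓡 n) ∞ x
  nondegenerate : ∀ (p : M) (u : TangentSpace (𝓡 m) p),
    (∀ v, inducedForm g.val x p u v = 0) → u = 0
  index_eq : ∀ p : M, sigNeg (quadForm (n := m) (inducedForm g.val x p)) = r

/-- `ξ` is a smooth vector field along `x`, normal to `M`, with `⟨ξ, ξ⟩ = ε`. -/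
structure IsUnitNormal (m : ℕ) {M : Type*} [TopologicalSpace M]
    [ChartedSpace (Coord m) M] (g : Metric n N) (x : M → N)
    (ξ : ∀ p : M, TangentSpace (𝓡 n) (x p)) (ε : ℝ) : Prop where
  contMDiff : ContMDiff (𝓡 m) (𝓡 n).tangent ∞ (fun p => (⟨x p, ξ p⟩ : TangentBundle (𝓡 n) N))
  normal : ∀ (p : M) (v : TangentSpace (𝓡 m) p),
    g.val (x p) (ξ p) (mfderiv (𝓡 m) (𝓡 n) x p v) = 0
  unit : ∀ p, g.val (x p) (ξ p) (ξ p) = ε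

/-- The shape operator `A` of `M` associated with `ξ`, at the point `p`, as a matrix with respect
to the coordinate basis of the preferred chart at `p`. -/
def shapeOperator (g : Metric n N) (x : M → N) (ξ : ∀ p : M, TangentSpace (𝓡 n) (x p)) (p : M) :
    Matrix (Fin m) (Fin m) ℝ :=
  shapeMatrix (coordForm (chartAt (Coord m) p) (inducedForm g.val x))
    (coordForm (chartAt (Coord n) (x p)) g.val)
    (coordMap (chartAt (Coord m) p) (chartAt (Coord n) (x p)) x)
    (coordField (chartAt (Coord m) p) (chartAt (Coord n) (x p)) x ξ)
    (chartAt (Coord m) p p)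

/-- The principal curvatures at `p`: the real and imaginary eigenvalues of the shape operator. -/
def principalCurvatures (g : Metric n N) (x : M → N) (ξ : ∀ p : M, TangentSpace (𝓡 n) (x p))
    (p : M) : Set ℂ :=
  {z | ((shapeOperator (m := m) g x ξ p).map (algebraMap ℝ ℂ)).charpoly.IsRoot z}

/-- The mean curvature `H = (1/m) ε tr A` of `M`, where `m = dim M`. -/
def meanCurvature (g : Metric n N) (x : M → N) (ξ : ∀ p : M, TangentSpace (𝓡 n) (x p)) (ε : ℝ)
    (p : M) : ℝ :=
  1 / (m : ℝ) * ε * (shapeOperator (m := m) g x ξ p).trace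

/-- The mean curvature vector field `H ξ`. -/
def meanCurvatureVector (g : Metric n N) (x : M → N) (ξ : ∀ p : M, TangentSpace (𝓡 n) (x p))
    (ε : ℝ) (p : M) : TangentSpace (𝓡 n) (x p) :=
  meanCurvature (m := m) g x ξ ε p • ξ p

/-- `Δ V = W` for vector fields `V`, `W` along the immersion `x`, where `Δ` is the Laplace operator
of `M` with the induced metric, formed with the Levi-Civita connections of `M` and `N`; the
equation is expressed in local coordinates of `M` and `N`. -/
def LaplacianEq (m : ℕ) {M : Type*} [TopologicalSpace M] [ChartedSpace (Coord m) M]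
    (g : Metric n N) (x : M → N) (V W : ∀ p : M, TangentSpace (𝓡 n) (x p)) : Prop :=
  ∀ φ ∈ atlas (Coord m) M, ∀ ψ ∈ atlas (Coord n) N, ∀ q ∈ φ.target, x (φ.symm q) ∈ ψ.source →
    laplacian (coordForm φ (inducedForm g.val x)) (coordForm ψ g.val) (coordMap φ ψ x)
      (coordField φ ψ x V) q = coordField φ ψ x W q

end Manifolds

end PseudoRiem

end

/-! The unique eigenvalue `a` of the shape operator `A` is real, so `A - a` is nilpotent, `a = ε H`
and `tr A² = m H²`, where `m = dim M`. Since `R(X, Y) ξ = 0` for `X` and `Y` tangent to `M`, the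
Codazzi equation holds, and `Δ(H ξ) = λ H ξ` splits into its tangential part
`A (grad H) = -(m / 2) ε H grad H` and its normal part `ε Δ H + H tr A² = ε λ H`. Where `H ≠ 0`, the
factor `-(m / 2) ε H` differs from `a`, so that `grad H = 0`; the normal part then gives
`H² = ε λ / m`. Thus `H²` is a continuous function with values in `{0, ε λ / m}`, hence constant. -/

set_option maxSynthPendingDepth 3

namespace PseudoRiem

section ScalarProduct

variable {E : Type*} [NormedAddCommGroup E] [NormedSpace ℝ E]

/-- A scalar product: a symmetric nondegenerate bilinear form, of arbitrary signature. Raising an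
index with `B` is `B.inverse : (E →L[ℝ] ℝ) →L[ℝ] E`. -/
structure IsScalarProduct (B : E →L[ℝ] E →L[ℝ] ℝ) : Prop where
  symm : ∀ u v, B u v = B v u
  nondegenerate : ∀ u, (∀ v, B u v = 0) → u = 0

namespace IsScalarProduct

variable {B : E →L[ℝ] E →L[ℝ] ℝ} (hB : IsScalarProduct B)
include hB

lemma eq_of_forall {u v : E} (h : ∀ w, B u w = B v w) : u = v :=
  sub_eq_zero.1 <| hB.nondegenerate _ fun w => by
    rw [map_sub, sub_apply, h, sub_self]

variable [FiniteDimensional ℝ E]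

lemma isInvertible : B.IsInvertible := by
  have hinj : Function.Injective B.toLinearMap := fun u v h =>
    hB.eq_of_forall fun w => DFunLike.congr_fun (show B u = B v from h) w
  have hdim : Module.finrank ℝ E = Module.finrank ℝ (E →L[ℝ] ℝ) :=
    Subspace.dual_finrank_eq.symm.trans LinearMap.toContinuousLinearMap.finrank_eq
  exact ⟨(LinearMap.linearEquivOfInjective B.toLinearMap hinj hdim).toContinuousLinearEquiv,
    rfl⟩

lemma apply_inverse (a : E →L[ℝ] ℝ) : B (B.inverse a) = a :=
  (hB.isInvertible.inverse_apply_eq.1 rfl).symm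

lemma inverse_apply (u : E) : B.inverse (B u) = u :=
  hB.isInvertible.inverse_apply_eq.2 rfl

lemma apply_apply_inverse (u : E) (a : E →L[ℝ] ℝ) : B u (B.inverse a) = a u := by
  rw [hB.symm, hB.apply_inverse]

end IsScalarProduct

end ScalarProduct

section Components

variable {n : ℕ}

lemma sum_smul_basisVec (v : Coord n) : ∑ i, v i • basisVec i = v := by
  simpa [basisVec] using (EuclideanSpace.basisFun (Fin n) ℝ).sum_repr v

lemma toBasis_basisFun_apply (i : Fin n) :
    (EuclideanSpace.basisFun (Fin n) ℝ).toBasis i = basisVec i := by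
  simp [basisVec]

lemma sum_smul_proj (a : Coord n →L[ℝ] ℝ) :
    ∑ l, a (basisVec l) • EuclideanSpace.proj l = a := by
  ext v
  conv_rhs => rw [← sum_smul_basisVec v, map_sum]
  simp [mul_comm]

namespace IsScalarProduct

variable {B : CoordForm n} (hB : IsScalarProduct B)
include hB

lemma gram_inv : (gram B)⁻¹ = Matrix.of fun k l => B.inverse (EuclideanSpace.proj l) k := by
  refine Matrix.inv_eq_right_inv ?_
  ext i l
  calc (gram B * Matrix.of fun k l => B.inverse (EuclideanSpace.proj l) k) i l
      = B (basisVec i) (∑ k, B.inverse (EuclideanSpace.proj l) k • basisVec k) := by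
        simp [Matrix.mul_apply, gram, mul_comm]
    _ = (1 : Matrix (Fin n) (Fin n) ℝ) i l := by
        rw [sum_smul_basisVec, hB.apply_apply_inverse]
        simp [basisVec, Matrix.one_apply, eq_comm]

lemma sum_gram_inv_smul (a : Coord n →L[ℝ] ℝ) :
    ∑ k, ∑ l, ((gram B)⁻¹ k l * a (basisVec l)) • basisVec k = B.inverse a := by
  calc ∑ k, ∑ l, ((gram B)⁻¹ k l * a (basisVec l)) • basisVec k
      = ∑ l, a (basisVec l) • ∑ k, B.inverse (EuclideanSpace.proj l) k • basisVec k := by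
        rw [Finset.sum_comm]
        simp only [hB.gram_inv, Matrix.of_apply, Finset.smul_sum, smul_smul, mul_comm]
    _ = B.inverse a := by
        simp only [sum_smul_basisVec, ← map_smul, ← map_sum, sum_smul_proj]

lemma sum_gram_inv_mul (T : CoordForm n) :
    ∑ i, ∑ j, (gram B)⁻¹ i j * T (basisVec i) (basisVec j)
      = LinearMap.trace ℝ (Coord n) (B.inverse ∘L T).toLinearMap := by
  rw [LinearMap.trace_eq_matrix_trace ℝ (EuclideanSpace.basisFun (Fin n) ℝ).toBasis,
    Matrix.trace]
  refine Finset.sum_congr rfl fun i _ => ?_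
  have h : (∑ k, ∑ l, ((gram B)⁻¹ k l * T (basisVec i) (basisVec l)) • basisVec k) i
      = B.inverse (T (basisVec i)) i := by rw [hB.sum_gram_inv_smul]
  simpa [LinearMap.toMatrix_apply, basisVec, Pi.single_apply] using h

end IsScalarProduct

end Components

section LeviCivita

variable {E : Type*} [NormedAddCommGroup E] [NormedSpace ℝ E]

lemma fderiv_form_apply {G : E → E →L[ℝ] E →L[ℝ] ℝ} {y : E} (hG : DifferentiableAt ℝ G y)
    (u v w : E) : fderiv ℝ (fun z => G z v w) y u = fderiv ℝ G y u v w := by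
  rw [fderiv_clm_apply (hG.clm_apply (differentiableAt_const _)) (differentiableAt_const _),
    fderiv_clm_apply hG (differentiableAt_const _)]
  simp

/-- `G` is a smooth pseudo-Riemannian metric on the open set `Ω`. -/
structure IsPseudoMetricOn (G : E → E →L[ℝ] E →L[ℝ] ℝ) (Ω : Set E) : Prop where
  isOpen : IsOpen Ω
  contDiffOn : ContDiffOn ℝ ∞ G Ω
  isScalarProduct : ∀ y ∈ Ω, IsScalarProduct (G y)

/-- The right-hand side `½ (∂ᵤ g(v, w) + ∂ᵥ g(u, w) - ∂_w g(u, v))` of the Koszul formula for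
constant vector fields. -/
noncomputable def koszulForm (G : E → E →L[ℝ] E →L[ℝ] ℝ) (y : E) : E →L[ℝ] E →L[ℝ] E →L[ℝ] ℝ :=
  (1 / 2 : ℝ) • (fderiv ℝ G y + (fderiv ℝ G y).flip
    - (ContinuousLinearMap.flipₗᵢ ℝ E E ℝ).toContinuousLinearEquiv.toContinuousLinearMap ∘L
      (fderiv ℝ G y).flip)

lemma koszulForm_apply (G : E → E →L[ℝ] E →L[ℝ] ℝ) (y u v w : E) :
    koszulForm G y u v w
      = 1 / 2 * (fderiv ℝ G y u v w + fderiv ℝ G y v u w - fderiv ℝ G y w u v) := by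
  simp [koszulForm]

/-- The Christoffel symbols as a field of bilinear maps. -/
noncomputable def christoffelMap (G : E → E →L[ℝ] E →L[ℝ] ℝ) (y : E) : E →L[ℝ] E →L[ℝ] E :=
  ContinuousLinearMap.compL ℝ E (E →L[ℝ] ℝ) E (G y).inverse ∘L koszulForm G y

namespace IsPseudoMetricOn

variable {G : E → E →L[ℝ] E →L[ℝ] ℝ} {Ω : Set E} (hG : IsPseudoMetricOn G Ω) {y : E}
include hG

lemma contDiffAt (hy : y ∈ Ω) : ContDiffAt ℝ ∞ G y :=
  hG.contDiffOn.contDiffAt (hG.isOpen.mem_nhds hy)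

lemma differentiableAt (hy : y ∈ Ω) : DifferentiableAt ℝ G y :=
  (hG.contDiffAt hy).differentiableAt (by simp)

lemma fderiv_symm (hy : y ∈ Ω) (u v w : E) : fderiv ℝ G y u v w = fderiv ℝ G y u w v := by
  have hsymm : (fun z => G z v w) =ᶠ[nhds y] fun z => G z w v := by
    filter_upwards [hG.isOpen.mem_nhds hy] with z hz using (hG.isScalarProduct z hz).symm v w
  rw [← fderiv_form_apply (hG.differentiableAt hy), hsymm.fderiv_eq,
    fderiv_form_apply (hG.differentiableAt hy)]

variable [FiniteDimensional ℝ E]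

lemma contDiffOn_inverse : ContDiffOn ℝ ∞ (fun y => (G y).inverse) Ω := fun y hy =>
  have := FiniteDimensional.complete ℝ E
  (((hG.isScalarProduct y hy).isInvertible.contDiffAt_map_inverse).comp y
    (hG.contDiffAt hy)).contDiffWithinAt

lemma contDiffOn_christoffelMap : ContDiffOn ℝ ∞ (christoffelMap G) Ω := by
  have hD : ContDiffOn ℝ ∞ (fderiv ℝ G) Ω := hG.contDiffOn.fderiv_of_isOpen hG.isOpen le_rfl
  have hD' : ContDiffOn ℝ ∞ (fun y => (fderiv ℝ G y).flip) Ω :=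
    (ContinuousLinearMap.flipₗᵢ ℝ E E (E →L[ℝ] ℝ)).contDiff.comp_contDiffOn hD
  exact ((ContinuousLinearMap.contDiff _).comp_contDiffOn hG.contDiffOn_inverse).clm_comp
    (((hD.add hD').sub (contDiffOn_const.clm_comp hD')).const_smul (1 / 2 : ℝ))

lemma koszul (hy : y ∈ Ω) (u v w : E) :
    G y (christoffelMap G y u v) w
      = 1 / 2 * (fderiv ℝ G y u v w + fderiv ℝ G y v u w - fderiv ℝ G y w u v) := by
  rw [← koszulForm_apply, christoffelMap]
  exact DFunLike.congr_fun ((hG.isScalarProduct y hy).apply_inverse _) w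

lemma christoffelMap_symm (hy : y ∈ Ω) (u v : E) :
    christoffelMap G y u v = christoffelMap G y v u :=
  (hG.isScalarProduct y hy).eq_of_forall fun w => by
    rw [hG.koszul hy, hG.koszul hy, hG.fderiv_symm hy w]
    ring

lemma fderiv_eq (hy : y ∈ Ω) (w u v : E) :
    fderiv ℝ G y w u v = G y (christoffelMap G y w u) v + G y u (christoffelMap G y w v) := by
  rw [(hG.isScalarProduct y hy).symm u, hG.koszul hy, hG.koszul hy, hG.fderiv_symm hy u w v,
    hG.fderiv_symm hy v w u, hG.fderiv_symm hy w v u]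
  ring

end IsPseudoMetricOn

lemma IsPseudoMetricOn.christoffel_eq {n : ℕ} {G : Coord n → CoordForm n} {Ω : Set (Coord n)}
    (hG : IsPseudoMetricOn G Ω) {y : Coord n} (hy : y ∈ Ω) (u v : Coord n) :
    christoffel G y u v = christoffelMap G y u v := by
  rw [christoffelMap, ContinuousLinearMap.comp_apply, ContinuousLinearMap.compL_apply,
    ContinuousLinearMap.comp_apply, ← (hG.isScalarProduct y hy).sum_gram_inv_smul]
  simp only [christoffel, koszulForm_apply]

end LeviCivita

section SecondDerivative

variable {E W : Type*} [NormedAddCommGroup E] [NormedSpace ℝ E]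
  [NormedAddCommGroup W] [NormedSpace ℝ W] {F : E → W} {q : E}

lemma differentiableAt_fderiv (hF : ContDiffAt ℝ 2 F q) : DifferentiableAt ℝ (fderiv ℝ F) q :=
  (hF.fderiv_right (m := 1) (by norm_num)).differentiableAt (by norm_num)

lemma differentiableAt_fderiv_apply (hF : ContDiffAt ℝ 2 F q) (v : E) :
    DifferentiableAt ℝ (fun z => fderiv ℝ F z v) q :=
  (differentiableAt_fderiv hF).clm_apply (differentiableAt_const _)

lemma fderiv_fderiv_apply (hF : ContDiffAt ℝ 2 F q) (u v : E) :
    fderiv ℝ (fun z => fderiv ℝ F z v) q u = fderiv ℝ (fderiv ℝ F) q u v := by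
  rw [fderiv_clm_apply (differentiableAt_fderiv hF) (differentiableAt_const _)]
  simp

lemma fderiv_fderiv_symm (hF : ContDiffAt ℝ 2 F q) (u v : E) :
    fderiv ℝ (fderiv ℝ F) q u v = fderiv ℝ (fderiv ℝ F) q v u :=
  (hF.isSymmSndFDerivAt (by rw [minSmoothness_of_isRCLikeNormedField])).eq u v

lemma contDiffAt_two {U : Set E} (hU : IsOpen U) (hF : ContDiffOn ℝ ∞ F U) (hq : q ∈ U) :
    ContDiffAt ℝ 2 F q :=
  (hF.contDiffAt (hU.mem_nhds hq)).of_le (WithTop.coe_le_coe.2 le_top)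

lemma differentiableAt_of_contDiffOn {U : Set E} (hU : IsOpen U) (hF : ContDiffOn ℝ ∞ F U)
    (hq : q ∈ U) : DifferentiableAt ℝ F q :=
  (contDiffAt_two hU hF hq).differentiableAt (by norm_num)

end SecondDerivative

section CovariantDerivative

variable {k m n : ℕ} {G : Coord n → CoordForm n} {F V W : Coord m → Coord n} {q : Coord m}

/-- The covariant differential `u ↦ ∇ᵤ V` of a vector field `V` along `F`. -/
noncomputable def covDifferential (G : Coord n → CoordForm n) (F V : Coord m → Coord n)
    (q : Coord m) : Coord m →L[ℝ] Coord n :=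
  fderiv ℝ V q + (christoffelMap G (F q)).flip (V q) ∘L fderiv ℝ F q

lemma covDeriv_congr {F' : Coord m → Coord n} (hF : F =ᶠ[nhds q] F') (hV : V =ᶠ[nhds q] W)
    (u : Coord m) : covDeriv G F V q u = covDeriv G F' W q u := by
  simp only [covDeriv, hF.fderiv_eq, hF.self_of_nhds, hV.fderiv_eq, hV.self_of_nhds]

lemma covDeriv_comp {F V : Coord m → Coord n} {κ : Coord k → Coord m} {q : Coord k}
    (hκ : DifferentiableAt ℝ κ q) (hF : DifferentiableAt ℝ F (κ q))
    (hV : DifferentiableAt ℝ V (κ q)) (u : Coord k) :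
    covDeriv G (fun z => F (κ z)) (fun z => V (κ z)) q u
      = covDeriv G F V (κ q) (fderiv ℝ κ q u) := by
  simp only [covDeriv, fderiv_fun_comp q hF hκ, fderiv_fun_comp q hV hκ,
    ContinuousLinearMap.comp_apply]

namespace IsPseudoMetricOn

variable {Ω : Set (Coord n)} (hG : IsPseudoMetricOn G Ω)
include hG

lemma covDeriv_eq (hq : F q ∈ Ω) (u : Coord m) :
    covDeriv G F V q u = fderiv ℝ V q u + christoffelMap G (F q) (fderiv ℝ F q u) (V q) := by
  rw [covDeriv, hG.christoffel_eq hq]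

lemma covDeriv_eq_covDifferential (hq : F q ∈ Ω) (u : Coord m) :
    covDeriv G F V q u = covDifferential G F V q u := by
  simp [hG.covDeriv_eq hq, covDifferential]

lemma contDiffOn_covDifferential {U : Set (Coord m)} (hU : IsOpen U) (hF : ContDiffOn ℝ ∞ F U)
    (hFU : Set.MapsTo F U Ω) (hV : ContDiffOn ℝ ∞ V U) :
    ContDiffOn ℝ ∞ (covDifferential G F V) U := by
  have hflip : ContDiffOn ℝ ∞ (fun z => (christoffelMap G (F z)).flip) U :=
    (ContinuousLinearMap.flipₗᵢ ℝ (Coord n) (Coord n) (Coord n)).contDiff.comp_contDiffOn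
      (hG.contDiffOn_christoffelMap.comp hF hFU)
  exact (hV.fderiv_of_isOpen hU le_rfl).add
    ((hflip.clm_apply hV).clm_comp (hF.fderiv_of_isOpen hU le_rfl))

lemma contDiffOn_covDeriv {U : Set (Coord m)} (hU : IsOpen U) (hF : ContDiffOn ℝ ∞ F U)
    (hFU : Set.MapsTo F U Ω) (hV : ContDiffOn ℝ ∞ V U) (u : Coord m) :
    ContDiffOn ℝ ∞ (fun z => covDeriv G F V z u) U :=
  ((hG.contDiffOn_covDifferential hU hF hFU hV).clm_apply contDiffOn_const).congr
    fun _ hz => hG.covDeriv_eq_covDifferential (hFU hz) u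

lemma covDeriv_add (hq : F q ∈ Ω) (hV : DifferentiableAt ℝ V q) (hW : DifferentiableAt ℝ W q)
    (u : Coord m) :
    covDeriv G F (fun z => V z + W z) q u = covDeriv G F V q u + covDeriv G F W q u := by
  simp only [hG.covDeriv_eq hq, fderiv_fun_add hV hW, map_add, add_apply]
  abel

lemma covDeriv_neg (hq : F q ∈ Ω) (u : Coord m) :
    covDeriv G F (fun z => -V z) q u = -covDeriv G F V q u := by
  simp only [hG.covDeriv_eq hq, fderiv_fun_neg, map_neg, neg_apply]
  abel

lemma covDeriv_smul {f : Coord m → ℝ} (hq : F q ∈ Ω) (hf : DifferentiableAt ℝ f q)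
    (hV : DifferentiableAt ℝ V q) (u : Coord m) :
    covDeriv G F (fun z => f z • V z) q u = fderiv ℝ f q u • V q + f q • covDeriv G F V q u := by
  simp only [hG.covDeriv_eq hq, fderiv_fun_smul hf hV, map_smul, add_apply, smul_apply,
    ContinuousLinearMap.smulRight_apply, smul_add]
  abel

lemma fderiv_comp_apply_apply (hq : F q ∈ Ω) (hF : DifferentiableAt ℝ F q)
    (hV : DifferentiableAt ℝ V q) (hW : DifferentiableAt ℝ W q) (u : Coord m) :
    fderiv ℝ (fun z => G (F z) (V z) (W z)) q u
      = G (F q) (covDeriv G F V q u) (W q) + G (F q) (V q) (covDeriv G F W q u) := by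
  have hGF : DifferentiableAt ℝ (fun z => G (F z)) q := (hG.differentiableAt hq).comp q hF
  rw [fderiv_clm_apply (hGF.clm_apply hV) hW, fderiv_clm_apply hGF hV,
    fderiv_fun_comp q (hG.differentiableAt hq) hF]
  simp only [hG.covDeriv_eq hq, add_apply, ContinuousLinearMap.comp_apply,
    ContinuousLinearMap.flip_apply, map_add, hG.fderiv_eq hq]
  ring

lemma covDeriv_fderiv_symm (hq : F q ∈ Ω) (hF : ContDiffAt ℝ 2 F q) (u v : Coord m) :
    covDeriv G F (fun z => fderiv ℝ F z v) q u = covDeriv G F (fun z => fderiv ℝ F z u) q v := by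
  simp only [hG.covDeriv_eq hq, fderiv_fderiv_apply hF, fderiv_fderiv_symm hF u v,
    hG.christoffelMap_symm hq (fderiv ℝ F q u)]

lemma fderiv_covDeriv (hq : F q ∈ Ω) (hF : ContDiffAt ℝ 2 F q) (hV : ContDiffAt ℝ 2 V q)
    (u v : Coord m) :
    fderiv ℝ (fun z => covDeriv G F V z v) q u = fderiv ℝ (fderiv ℝ V) q u v
      + (fderiv ℝ (christoffelMap G) (F q) (fderiv ℝ F q u) (fderiv ℝ F q v) (V q)
        + christoffelMap G (F q) (fderiv ℝ (fderiv ℝ F) q u v) (V q)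
        + christoffelMap G (F q) (fderiv ℝ F q v) (fderiv ℝ V q u)) := by
  have hFd := hF.differentiableAt (by norm_num)
  have hVd := hV.differentiableAt (by norm_num)
  have hΓ := differentiableAt_of_contDiffOn hG.isOpen hG.contDiffOn_christoffelMap hq
  have hΓF : DifferentiableAt ℝ (fun z => christoffelMap G (F z)) q := hΓ.comp q hFd
  have hFv := differentiableAt_fderiv_apply hF v
  have hexpand : (fun z => covDeriv G F V z v) =ᶠ[nhds q]
      fun z => fderiv ℝ V z v + christoffelMap G (F z) (fderiv ℝ F z v) (V z) := by
    filter_upwards [hFd.continuousAt (hG.isOpen.mem_nhds hq)] with z hz using hG.covDeriv_eq hz v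
  rw [hexpand.fderiv_eq, fderiv_fun_add (differentiableAt_fderiv_apply hV v)
    ((hΓF.clm_apply hFv).clm_apply hVd), add_apply, fderiv_fderiv_apply hV,
    fderiv_clm_apply (hΓF.clm_apply hFv) hVd, fderiv_clm_apply hΓF hFv, fderiv_fun_comp q hΓ hFd]
  simp only [add_apply, ContinuousLinearMap.comp_apply, ContinuousLinearMap.flip_apply,
    fderiv_fderiv_apply hF]
  abel

lemma curvature_eq {y : Coord n} (hy : y ∈ Ω) (u v w : Coord n) :
    curvature G y u v w
      = fderiv ℝ (christoffelMap G) y u v w - fderiv ℝ (christoffelMap G) y v u w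
        + christoffelMap G y u (christoffelMap G y v w)
        - christoffelMap G y v (christoffelMap G y u w) := by
  have hcov (u v : Coord n) : covDeriv G id (fun z => covDeriv G id (fun _ => w) z v) y u
      = fderiv ℝ (christoffelMap G) y u v w
        + christoffelMap G y u (christoffelMap G y v w) := by
    rw [hG.covDeriv_eq (F := id) hy, hG.fderiv_covDeriv (F := id) hy contDiffAt_id contDiffAt_const,
      hG.covDeriv_eq (F := id) hy]
    have hid : fderiv ℝ (fderiv ℝ (id : Coord n → Coord n)) y = 0 := by
      rw [show fderiv ℝ (id : Coord n → Coord n) = fun _ => .id ℝ _ from funext fun _ => fderiv_id]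
      simp
    simp [hid]
  rw [curvature, hcov, hcov]
  abel

lemma covDeriv_covDeriv_sub (hq : F q ∈ Ω) (hF : ContDiffAt ℝ 2 F q) (hV : ContDiffAt ℝ 2 V q)
    (u v : Coord m) :
    covDeriv G F (fun z => covDeriv G F V z v) q u - covDeriv G F (fun z => covDeriv G F V z u) q v
      = curvature G (F q) (fderiv ℝ F q u) (fderiv ℝ F q v) (V q) := by
  rw [hG.curvature_eq hq]
  simp only [hG.covDeriv_eq hq, hG.fderiv_covDeriv hq hF hV, fderiv_fderiv_symm hF u v,
    fderiv_fderiv_symm hV u v, map_add]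
  abel

end IsPseudoMetricOn

end CovariantDerivative

section IsometricImmersion

/-- `F` is a smooth map from the open set `U` with the metric `h` to the open set `Ω` with the
metric `G`, and `h` is the metric induced by `F`; since `h` is nondegenerate, `F` is an
immersion. -/
structure IsIsometricImmersionOn {m n : ℕ} (h : Coord m → CoordForm m) (U : Set (Coord m))
    (G : Coord n → CoordForm n) (Ω : Set (Coord n)) (F : Coord m → Coord n) : Prop where
  source : IsPseudoMetricOn h U
  target : IsPseudoMetricOn G Ω
  mapsTo : Set.MapsTo F U Ω
  contDiffOn : ContDiffOn ℝ ∞ F U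
  isometric : ∀ q ∈ U, ∀ u v, G (F q) (fderiv ℝ F q u) (fderiv ℝ F q v) = h q u v

namespace IsIsometricImmersionOn

lemma of_nondegenerate {m n : ℕ} {h : Coord m → CoordForm m} {U : Set (Coord m)}
    {G : Coord n → CoordForm n} {Ω : Set (Coord n)} {F : Coord m → Coord n} (hU : IsOpen U)
    (hG : IsPseudoMetricOn G Ω) (hmaps : Set.MapsTo F U Ω) (hF : ContDiffOn ℝ ∞ F U)
    (hiso : ∀ q ∈ U, ∀ u v, G (F q) (fderiv ℝ F q u) (fderiv ℝ F q v) = h q u v)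
    (hnondeg : ∀ q ∈ U, ∀ u, (∀ v, h q u v = 0) → u = 0) :
    IsIsometricImmersionOn h U G Ω F where
  source :=
    { isOpen := hU
      contDiffOn := contDiffOn_clm_apply.2 fun u => contDiffOn_clm_apply.2 fun v => by
        have hderiv (w : Coord m) : ContDiffOn ℝ ∞ (fun q => fderiv ℝ F q w) U :=
          (hF.fderiv_of_isOpen hU le_rfl).clm_apply contDiffOn_const
        exact (((hG.contDiffOn.comp hF hmaps).clm_apply (hderiv u)).clm_apply (hderiv v)).congr
          fun q hq => (hiso q hq u v).symm
      isScalarProduct := fun q hq =>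
        { symm := fun u v => by
            rw [← hiso q hq, ← hiso q hq, (hG.isScalarProduct _ (hmaps hq)).symm]
          nondegenerate := hnondeg q hq } }
  target := hG
  mapsTo := hmaps
  contDiffOn := hF
  isometric := hiso

variable {m n : ℕ} {h : Coord m → CoordForm m} {U : Set (Coord m)} {G : Coord n → CoordForm n}
  {Ω : Set (Coord n)} {F : Coord m → Coord n} (hF : IsIsometricImmersionOn h U G Ω F)
  {q : Coord m}
include hF

lemma contDiffAt (hq : q ∈ U) : ContDiffAt ℝ 2 F q :=
  contDiffAt_two hF.source.isOpen hF.contDiffOn hq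

lemma differentiableAt (hq : q ∈ U) : DifferentiableAt ℝ F q :=
  (hF.contDiffAt hq).differentiableAt (by norm_num)

lemma injective_fderiv (hq : q ∈ U) : Function.Injective (fderiv ℝ F q) := fun u v huv =>
  (hF.source.isScalarProduct q hq).eq_of_forall fun w => by
    rw [← hF.isometric q hq, ← hF.isometric q hq, huv]

lemma fderiv_source_apply (hq : q ∈ U) (u v w : Coord m) :
    fderiv ℝ h q u v w = G (F q) (covDeriv G F (fun z => fderiv ℝ F z v) q u) (fderiv ℝ F q w)
      + G (F q) (fderiv ℝ F q v) (covDeriv G F (fun z => fderiv ℝ F z w) q u) := by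
  have hind : (fun z => h z v w) =ᶠ[nhds q]
      fun z => G (F z) (fderiv ℝ F z v) (fderiv ℝ F z w) := by
    filter_upwards [hF.source.isOpen.mem_nhds hq] with z hz using (hF.isometric z hz v w).symm
  rw [← fderiv_form_apply (hF.source.differentiableAt hq), hind.fderiv_eq,
    hF.target.fderiv_comp_apply_apply (hF.mapsTo hq)
    (hF.differentiableAt hq) (differentiableAt_fderiv_apply (hF.contDiffAt hq) v)
    (differentiableAt_fderiv_apply (hF.contDiffAt hq) w)]

lemma apply_covDeriv_fderiv (hq : q ∈ U) (u v w : Coord m) :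
    G (F q) (covDeriv G F (fun z => fderiv ℝ F z v) q u) (fderiv ℝ F q w)
      = h q (christoffel h q u v) w := by
  have hsymm := (hF.target.isScalarProduct _ (hF.mapsTo hq)).symm
  have htorsion := hF.target.covDeriv_fderiv_symm (hF.mapsTo hq) (hF.contDiffAt hq)
  rw [hF.source.christoffel_eq hq, hF.source.koszul hq, hF.fderiv_source_apply hq,
    hF.fderiv_source_apply hq, hF.fderiv_source_apply hq, htorsion v u, htorsion w u,
    htorsion w v, hsymm (fderiv ℝ F q v), hsymm (fderiv ℝ F q u)]
  ring

end IsIsometricImmersionOn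

namespace IsIsometricImmersionOn

variable {m n : ℕ} {G G' : Coord n → CoordForm n} {Ω Ω' : Set (Coord n)} {θ : Coord n → Coord n}
  (hθ : IsIsometricImmersionOn G Ω G' Ω' θ)
include hθ

lemma surjective_fderiv {y : Coord n} (hy : y ∈ Ω) : Function.Surjective (fderiv ℝ θ y) :=
  LinearMap.surjective_of_injective (f := (fderiv ℝ θ y).toLinearMap) (hθ.injective_fderiv hy)

lemma fderiv_christoffelMap {y : Coord n} (hy : y ∈ Ω) (a b : Coord n) :
    fderiv ℝ θ y (christoffelMap G y a b) = fderiv ℝ (fderiv ℝ θ) y a b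
      + christoffelMap G' (θ y) (fderiv ℝ θ y a) (fderiv ℝ θ y b) := by
  refine (hθ.target.isScalarProduct _ (hθ.mapsTo hy)).eq_of_forall fun w' => ?_
  obtain ⟨w, rfl⟩ := hθ.surjective_fderiv hy w'
  rw [hθ.isometric y hy, ← hθ.source.christoffel_eq hy, ← hθ.apply_covDeriv_fderiv hy,
    hθ.target.covDeriv_eq (hθ.mapsTo hy), fderiv_fderiv_apply (hθ.contDiffAt hy)]

lemma covDeriv_map {F V : Coord m → Coord n} {q : Coord m} (hF : DifferentiableAt ℝ F q)
    (hV : DifferentiableAt ℝ V q) (hq : F q ∈ Ω) (u : Coord m) :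
    covDeriv G' (fun z => θ (F z)) (fun z => fderiv ℝ θ (F z) (V z)) q u
      = fderiv ℝ θ (F q) (covDeriv G F V q u) := by
  have hθ' := differentiableAt_fderiv (hθ.contDiffAt hq)
  have hθF : DifferentiableAt ℝ (fun z => fderiv ℝ θ (F z)) q := hθ'.comp q hF
  rw [hθ.target.covDeriv_eq (F := fun z => θ (F z)) (hθ.mapsTo hq),
    hθ.source.covDeriv_eq hq, fderiv_clm_apply hθF hV,
    fderiv_fun_comp q (hθ.differentiableAt hq) hF, fderiv_fun_comp q hθ' hF]
  simp only [add_apply, ContinuousLinearMap.comp_apply, ContinuousLinearMap.flip_apply, map_add,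
    hθ.fderiv_christoffelMap hq]
  abel

end IsIsometricImmersionOn

end IsometricImmersion

section Endomorphisms

variable {m : ℕ} {h : Coord m → CoordForm m} {U : Set (Coord m)}
  {A : Coord m → Coord m →L[ℝ] Coord m} {q : Coord m}

/-- The covariant derivative `∇_w A` of a field `A` of endomorphisms of the tangent spaces. -/
noncomputable def covDerivEnd (h : Coord m → CoordForm m) (A : Coord m → Coord m →L[ℝ] Coord m)
    (q w : Coord m) : Coord m →L[ℝ] Coord m :=
  fderiv ℝ A q w + (christoffelMap h q w ∘L A q - A q ∘L christoffelMap h q w)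

lemma trace_covDerivEnd (w : Coord m) :
    LinearMap.trace ℝ (Coord m) (covDerivEnd h A q w).toLinearMap
      = LinearMap.trace ℝ (Coord m) (fderiv ℝ A q w).toLinearMap := by
  have hcomm := LinearMap.trace_mul_comm ℝ (christoffelMap h q w).toLinearMap (A q).toLinearMap
  simp only [covDerivEnd, ContinuousLinearMap.toLinearMap_add, ContinuousLinearMap.toLinearMap_sub,
    ContinuousLinearMap.toLinearMap_comp, map_add, map_sub]
  rw [← Module.End.mul_eq_comp, ← Module.End.mul_eq_comp, hcomm, sub_self, add_zero]

lemma IsPseudoMetricOn.covDeriv_id_apply (hh : IsPseudoMetricOn h U) (hq : q ∈ U)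
    (hA : DifferentiableAt ℝ A q) (u v : Coord m) :
    covDeriv h id (fun z => A z v) q u = covDerivEnd h A q u v + A q (christoffel h q u v) := by
  rw [hh.covDeriv_eq (F := id) hq, fderiv_clm_apply hA (differentiableAt_const _),
    hh.christoffel_eq hq]
  simp only [covDerivEnd, id, fderiv_id, ContinuousLinearMap.id_apply, fderiv_fun_const,
    Pi.zero_apply, ContinuousLinearMap.comp_zero, zero_add, add_apply, sub_apply,
    ContinuousLinearMap.comp_apply, ContinuousLinearMap.flip_apply]
  abel

lemma IsPseudoMetricOn.apply_covDerivEnd_symm (hh : IsPseudoMetricOn h U) (hq : q ∈ U)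
    (hA : DifferentiableAt ℝ A q) (hsymm : ∀ z ∈ U, ∀ u v, h z (A z u) v = h z (A z v) u)
    (w u v : Coord m) : h q (covDerivEnd h A q w u) v = h q (covDerivEnd h A q w v) u := by
  have hderiv (u v : Coord m) : fderiv ℝ (fun z => h z (A z u) v) q w
      = h q (covDerivEnd h A q w u) v + h q (A q (christoffel h q w u)) v
        + h q (A q (christoffel h q w v)) u := by
    have hcompat := hh.fderiv_comp_apply_apply (F := id) (V := fun z => A z u) (W := fun _ => v)
      hq differentiableAt_id (hA.clm_apply (differentiableAt_const _)) (differentiableAt_const _) w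
    have hconst : covDeriv h id (fun _ => v) q w = christoffel h q w v := by simp [covDeriv]
    rw [hh.covDeriv_id_apply hq hA, hconst, id, map_add, add_apply,
      hsymm q hq u (christoffel h q w v)] at hcompat
    exact hcompat
  have hnear : (fun z => h z (A z u) v) =ᶠ[nhds q] fun z => h z (A z v) u := by
    filter_upwards [hh.isOpen.mem_nhds hq] with z hz using hsymm z hz u v
  have heq := hderiv u v
  rw [hnear.fderiv_eq, hderiv v u] at heq
  linarith

end Endomorphisms

section Laplacian

variable {m n : ℕ} {h : Coord m → CoordForm m} {G : Coord n → CoordForm n}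
  {Ω : Set (Coord n)} {F V : Coord m → Coord n} {q : Coord m}

/-- The Hessian `∇df` of a function on a domain with the metric `h`. -/
noncomputable def hessian (h : Coord m → CoordForm m) (f : Coord m → ℝ) (q : Coord m) :
    CoordForm m :=
  fderiv ℝ (fderiv ℝ f) q
    - ContinuousLinearMap.compL ℝ (Coord m) (Coord m) ℝ (fderiv ℝ f q) ∘L christoffelMap h q

lemma IsScalarProduct.apply_laplacian (hh : IsScalarProduct (h q)) {T : CoordForm m}
    {B : CoordForm n} {Z : Coord n} (hT : ∀ u v, B (secondCovDeriv h G F V q u v) Z = T u v) :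
    B (laplacian h G F V q) Z
      = -LinearMap.trace ℝ (Coord m) ((h q).inverse ∘L T).toLinearMap := by
  simp only [← hh.sum_gram_inv_mul, ← hT, laplacian, map_neg, map_sum, map_smul, neg_apply,
    sum_apply, smul_apply, smul_eq_mul]

lemma IsIsometricImmersionOn.secondCovDeriv_smul {U : Set (Coord m)}
    (hF : IsIsometricImmersionOn h U G Ω F) {f : Coord m → ℝ} (hf : ContDiffOn ℝ ∞ f U)
    (hV : ContDiffOn ℝ ∞ V U) (hq : q ∈ U) (u v : Coord m) :
    secondCovDeriv h G F (fun z => f z • V z) q u v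
      = hessian h f q u v • V q + fderiv ℝ f q v • covDeriv G F V q u
        + fderiv ℝ f q u • covDeriv G F V q v + f q • secondCovDeriv h G F V q u v := by
  have hU := hF.source.isOpen
  have hFq := hF.mapsTo hq
  have hfd (z) (hz : z ∈ U) := differentiableAt_of_contDiffOn hU hf hz
  have hVd (z) (hz : z ∈ U) := differentiableAt_of_contDiffOn hU hV hz
  have hfv := differentiableAt_fderiv_apply (contDiffAt_two hU hf hq) v
  have hVv := differentiableAt_of_contDiffOn hU
    (hF.target.contDiffOn_covDeriv hU hF.contDiffOn hF.mapsTo hV v) hq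
  have hnear : (fun z => covDeriv G F (fun z => f z • V z) z v) =ᶠ[nhds q]
      fun z => fderiv ℝ f z v • V z + f z • covDeriv G F V z v := by
    filter_upwards [hU.mem_nhds hq] with z hz
    exact hF.target.covDeriv_smul (hF.mapsTo hz) (hfd z hz) (hVd z hz) v
  rw [secondCovDeriv, covDeriv_congr .rfl hnear,
    hF.target.covDeriv_add hFq (hfv.fun_smul (hVd q hq)) ((hfd q hq).fun_smul hVv),
    hF.target.covDeriv_smul hFq hfv (hVd q hq), hF.target.covDeriv_smul hFq (hfd q hq) hVv,
    hF.target.covDeriv_smul hFq (hfd q hq) (hVd q hq),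
    fderiv_fderiv_apply (contDiffAt_two hU hf hq), secondCovDeriv, hessian,
    hF.source.christoffel_eq hq]
  simp only [sub_apply, ContinuousLinearMap.comp_apply, ContinuousLinearMap.compL_apply, sub_smul,
    smul_sub]
  abel

end Laplacian

section ShapeOperator

variable {m n : ℕ} {h : Coord m → CoordForm m} {U : Set (Coord m)} {G : Coord n → CoordForm n}
  {Ω : Set (Coord n)} {F ξ : Coord m → Coord n} {q : Coord m}

/-- The shape operator `A`, defined by `h(A u, w) = ⟨-∇ᵤ ξ, F_* w⟩`. -/
noncomputable def shapeOp (h : Coord m → CoordForm m) (G : Coord n → CoordForm n)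
    (F ξ : Coord m → Coord n) (q : Coord m) : Coord m →L[ℝ] Coord m :=
  -((h q).inverse ∘L (ContinuousLinearMap.compL ℝ (Coord m) (Coord n) ℝ).flip (fderiv ℝ F q) ∘L
    G (F q) ∘L covDifferential G F ξ q)

namespace IsIsometricImmersionOn

variable (hF : IsIsometricImmersionOn h U G Ω F)
include hF

lemma apply_shapeOp (hq : q ∈ U) (u w : Coord m) :
    h q (shapeOp h G F ξ q u) w = -G (F q) (covDeriv G F ξ q u) (fderiv ℝ F q w) := by
  rw [hF.target.covDeriv_eq_covDifferential (hF.mapsTo hq)]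
  simp [shapeOp, (hF.source.isScalarProduct q hq).apply_inverse]

lemma contDiffOn_shapeOp (hξ : ContDiffOn ℝ ∞ ξ U) : ContDiffOn ℝ ∞ (shapeOp h G F ξ) U := by
  have hU := hF.source.isOpen
  have hpull : ContDiffOn ℝ ∞ (fun q => (ContinuousLinearMap.compL ℝ (Coord m) (Coord n) ℝ).flip
      (fderiv ℝ F q)) U :=
    (ContinuousLinearMap.contDiff _).comp_contDiffOn (hF.contDiffOn.fderiv_of_isOpen hU le_rfl)
  exact (hF.source.contDiffOn_inverse.clm_comp (hpull.clm_comp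
    ((hF.target.contDiffOn.comp hF.contDiffOn hF.mapsTo).clm_comp
      (hF.target.contDiffOn_covDifferential hU hF.contDiffOn hF.mapsTo hξ)))).neg

lemma shapeMatrix_eq_toMatrix (hq : q ∈ U) :
    shapeMatrix h G F ξ q = LinearMap.toMatrix (EuclideanSpace.basisFun (Fin m) ℝ).toBasis
      (EuclideanSpace.basisFun (Fin m) ℝ).toBasis (shapeOp h G F ξ q).toLinearMap := by
  ext i l
  have hinv := (hF.source.isScalarProduct q hq).inverse_apply (shapeOp h G F ξ q (basisVec l))
  rw [← (hF.source.isScalarProduct q hq).sum_gram_inv_smul] at hinv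
  simp only [hF.apply_shapeOp hq] at hinv
  rw [LinearMap.toMatrix_apply, toBasis_basisFun_apply]
  have := congrArg (fun v : Coord m => v i) hinv
  simpa [shapeMatrix, basisVec, Pi.single_apply] using this

end IsIsometricImmersionOn

/-- `F` is an isometric immersion and `ξ` is a smooth unit normal field along `F`, of causal
character `ε = ±1`. -/
structure IsHypersurfaceOn (h : Coord m → CoordForm m) (U : Set (Coord m))
    (G : Coord n → CoordForm n) (Ω : Set (Coord n)) (F ξ : Coord m → Coord n) (ε : ℝ) : Prop
    extends IsIsometricImmersionOn h U G Ω F where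
  contDiffOn_normal : ContDiffOn ℝ ∞ ξ U
  normal : ∀ q ∈ U, ∀ v, G (F q) (ξ q) (fderiv ℝ F q v) = 0
  unit : ∀ q ∈ U, G (F q) (ξ q) (ξ q) = ε
  eps_mul_self : ε * ε = 1

namespace IsHypersurfaceOn

variable {ε : ℝ} (hF : IsHypersurfaceOn h U G Ω F ξ ε)
include hF

lemma symm (hq : q ∈ U) (a b : Coord n) : G (F q) a b = G (F q) b a :=
  (hF.target.isScalarProduct _ (hF.mapsTo hq)).symm a b

lemma normal' (hq : q ∈ U) (v : Coord m) : G (F q) (fderiv ℝ F q v) (ξ q) = 0 := by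
  rw [hF.symm hq, hF.normal q hq]

lemma differentiableAt_normal (hq : q ∈ U) : DifferentiableAt ℝ ξ q :=
  differentiableAt_of_contDiffOn hF.source.isOpen hF.contDiffOn_normal hq

lemma differentiableAt_shapeOp (hq : q ∈ U) : DifferentiableAt ℝ (shapeOp h G F ξ) q :=
  differentiableAt_of_contDiffOn hF.source.isOpen (hF.contDiffOn_shapeOp hF.contDiffOn_normal) hq

lemma apply_covDeriv_normal_normal (hq : q ∈ U) (u : Coord m) :
    G (F q) (covDeriv G F ξ q u) (ξ q) = 0 := by
  have hconst : (fun z => G (F z) (ξ z) (ξ z)) =ᶠ[nhds q] fun _ => ε := by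
    filter_upwards [hF.source.isOpen.mem_nhds hq] with z hz using hF.unit z hz
  have hderiv := hF.target.fderiv_comp_apply_apply (hF.mapsTo hq) (hF.differentiableAt hq)
    (hF.differentiableAt_normal hq) (hF.differentiableAt_normal hq) u
  rw [hconst.fderiv_eq, hF.symm hq (ξ q)] at hderiv
  simp only [fderiv_fun_const, Pi.zero_apply, zero_apply] at hderiv
  linarith

lemma apply_covDeriv_fderiv_normal (hq : q ∈ U) (u v : Coord m) :
    G (F q) (covDeriv G F (fun z => fderiv ℝ F z v) q u) (ξ q)
      = h q (shapeOp h G F ξ q u) v := by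
  have hzero : (fun z => G (F z) (ξ z) (fderiv ℝ F z v)) =ᶠ[nhds q] fun _ => 0 := by
    filter_upwards [hF.source.isOpen.mem_nhds hq] with z hz using hF.normal z hz v
  have hderiv := hF.target.fderiv_comp_apply_apply (hF.mapsTo hq) (hF.differentiableAt hq)
    (hF.differentiableAt_normal hq) (differentiableAt_fderiv_apply (hF.contDiffAt hq) v) u
  rw [hzero.fderiv_eq, hF.symm hq (ξ q)] at hderiv
  simp only [fderiv_fun_const, Pi.zero_apply, zero_apply] at hderiv
  rw [hF.apply_shapeOp hq]
  linarith

lemma shapeOp_symm (hq : q ∈ U) (u v : Coord m) :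
    h q (shapeOp h G F ξ q u) v = h q (shapeOp h G F ξ q v) u := by
  rw [← hF.apply_covDeriv_fderiv_normal hq, ← hF.apply_covDeriv_fderiv_normal hq,
    hF.target.covDeriv_fderiv_symm (hF.mapsTo hq) (hF.contDiffAt hq)]

end IsHypersurfaceOn

end ShapeOperator

namespace IsHypersurfaceOn

variable {m : ℕ} {h : Coord m → CoordForm m} {U : Set (Coord m)}
  {G : Coord (m + 1) → CoordForm (m + 1)} {Ω : Set (Coord (m + 1))}
  {F ξ : Coord m → Coord (m + 1)} {ε : ℝ} (hF : IsHypersurfaceOn h U G Ω F ξ ε) {q : Coord m}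
include hF

lemma exists_eq_smul_normal_add (hq : q ∈ U) (a : Coord (m + 1)) :
    ∃ (t : ℝ) (u : Coord m), a = t • ξ q + fderiv ℝ F q u := by
  let L : ℝ × Coord m →ₗ[ℝ] Coord (m + 1) :=
    (LinearMap.toSpanSingleton ℝ _ (ξ q)).coprod (fderiv ℝ F q).toLinearMap
  have hL (t : ℝ) (u : Coord m) : L (t, u) = t • ξ q + fderiv ℝ F q u := rfl
  have hinj : Function.Injective L := by
    refine (injective_iff_map_eq_zero L).2 fun ⟨t, u⟩ htu => ?_
    rw [hL] at htu
    have hnormal := congrArg (G (F q) (ξ q)) htu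
    have ht : t = 0 := by
      simp only [map_add, map_smul, hF.unit q hq, hF.normal q hq, smul_eq_mul, add_zero, map_zero]
        at hnormal
      exact (mul_eq_zero.1 hnormal).resolve_right fun h0 => by
        simpa [h0] using hF.eps_mul_self
    rw [ht, zero_smul, zero_add] at htu
    rw [ht, (injective_iff_map_eq_zero _).1 (hF.injective_fderiv hq) u htu, Prod.mk_zero_zero]
  have hdim : Module.finrank ℝ (ℝ × Coord m) = Module.finrank ℝ (Coord (m + 1)) := by
    simp [add_comm]
  obtain ⟨⟨t, u⟩, h⟩ := (LinearMap.injective_iff_surjective_of_finrank_eq_finrank hdim).1 hinj a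
  exact ⟨t, u, h.symm⟩

lemma eq_of_apply_eq (hq : q ∈ U) {a b : Coord (m + 1)}
    (hnormal : G (F q) a (ξ q) = G (F q) b (ξ q))
    (htangent : ∀ w, G (F q) a (fderiv ℝ F q w) = G (F q) b (fderiv ℝ F q w)) : a = b := by
  refine (hF.target.isScalarProduct _ (hF.mapsTo hq)).eq_of_forall fun c => ?_
  obtain ⟨t, u, rfl⟩ := hF.exists_eq_smul_normal_add hq c
  simp only [map_add, map_smul, hnormal, htangent]

lemma weingarten (hq : q ∈ U) (u : Coord m) :
    covDeriv G F ξ q u = -fderiv ℝ F q (shapeOp h G F ξ q u) := by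
  refine hF.eq_of_apply_eq hq ?_ fun w => ?_
  · rw [hF.apply_covDeriv_normal_normal hq, map_neg, neg_apply, hF.normal' hq, neg_zero]
  · rw [map_neg, neg_apply, hF.isometric q hq, hF.apply_shapeOp hq, neg_neg]

lemma gauss_const (hq : q ∈ U) (u v : Coord m) :
    covDeriv G F (fun z => fderiv ℝ F z v) q u = fderiv ℝ F q (christoffel h q u v)
      + (ε * h q (shapeOp h G F ξ q u) v) • ξ q := by
  refine hF.eq_of_apply_eq hq ?_ fun w => ?_
  · simp only [map_add, map_smul, add_apply, smul_apply, smul_eq_mul, hF.normal' hq,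
      hF.unit q hq, hF.apply_covDeriv_fderiv_normal hq]
    linear_combination -(h q (shapeOp h G F ξ q u) v) * hF.eps_mul_self
  · simp only [map_add, map_smul, add_apply, smul_apply, smul_eq_mul, hF.normal q hq,
      hF.isometric q hq, hF.apply_covDeriv_fderiv hq, mul_zero, add_zero]

lemma gauss {Y : Coord m → Coord m} (hq : q ∈ U) (hY : DifferentiableAt ℝ Y q) (u : Coord m) :
    covDeriv G F (fun z => fderiv ℝ F z (Y z)) q u = fderiv ℝ F q (covDeriv h id Y q u)
      + (ε * h q (shapeOp h G F ξ q u) (Y q)) • ξ q := by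
  have hF2 := hF.contDiffAt hq
  have hconst := hF.gauss_const hq u (Y q)
  rw [hF.target.covDeriv_eq (hF.mapsTo hq), fderiv_fderiv_apply hF2] at hconst
  rw [hF.target.covDeriv_eq (hF.mapsTo hq),
    fderiv_clm_apply (differentiableAt_fderiv hF2) hY]
  simp only [add_apply, ContinuousLinearMap.comp_apply, ContinuousLinearMap.flip_apply]
  rw [add_assoc, hconst, covDeriv, map_add, fderiv_id]
  simp only [id, ContinuousLinearMap.id_apply, add_assoc]

lemma covDeriv_covDeriv_normal (hq : q ∈ U) (u v : Coord m) :
    covDeriv G F (fun z => covDeriv G F ξ z v) q u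
      = -fderiv ℝ F q (covDerivEnd h (shapeOp h G F ξ) q u v
          + shapeOp h G F ξ q (christoffel h q u v))
        - (ε * h q (shapeOp h G F ξ q u) (shapeOp h G F ξ q v)) • ξ q := by
  have hA := hF.differentiableAt_shapeOp hq
  have hnear : (fun z => covDeriv G F ξ z v) =ᶠ[nhds q]
      fun z => -fderiv ℝ F z (shapeOp h G F ξ z v) := by
    filter_upwards [hF.source.isOpen.mem_nhds hq] with z hz using hF.weingarten hz v
  rw [covDeriv_congr .rfl hnear, hF.target.covDeriv_neg (hF.mapsTo hq),
    hF.gauss hq (hA.clm_apply (differentiableAt_const v)),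
    hF.source.covDeriv_id_apply hq hA]
  abel

lemma secondCovDeriv_normal (hq : q ∈ U) (u v : Coord m) :
    secondCovDeriv h G F ξ q u v = -fderiv ℝ F q (covDerivEnd h (shapeOp h G F ξ) q u v)
      - (ε * h q (shapeOp h G F ξ q u) (shapeOp h G F ξ q v)) • ξ q := by
  rw [secondCovDeriv, hF.covDeriv_covDeriv_normal hq, hF.weingarten hq, map_add]
  abel

lemma codazzi (hq : q ∈ U) {u v : Coord m}
    (hcurv : curvature G (F q) (fderiv ℝ F q u) (fderiv ℝ F q v) (ξ q) = 0) :
    covDerivEnd h (shapeOp h G F ξ) q u v = covDerivEnd h (shapeOp h G F ξ) q v u := by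
  have hcomm := hF.target.covDeriv_covDeriv_sub (hF.mapsTo hq) (hF.contDiffAt hq)
    (contDiffAt_two hF.source.isOpen hF.contDiffOn_normal hq) u v
  rw [hcurv, hF.covDeriv_covDeriv_normal hq, hF.covDeriv_covDeriv_normal hq,
    (hF.source.isScalarProduct q hq).symm (shapeOp h G F ξ q v),
    hF.source.christoffel_eq hq u, hF.source.christoffel_eq hq v,
    hF.source.christoffelMap_symm hq v u, map_add, map_add] at hcomm
  refine hF.injective_fderiv hq (sub_eq_zero.1 ?_)
  rw [← neg_eq_zero, ← hcomm]
  abel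

end IsHypersurfaceOn

/-- The trace of endomorphisms of `ℝᵐ`, as a continuous linear form. -/
noncomputable def traceCLM (m : ℕ) : (Coord m →L[ℝ] Coord m) →L[ℝ] ℝ :=
  (LinearMap.trace ℝ (Coord m) ∘ₗ ContinuousLinearMap.coeLM ℝ).toContinuousLinearMap

lemma fderiv_trace {m : ℕ} {A : Coord m → Coord m →L[ℝ] Coord m} {q : Coord m}
    (hA : DifferentiableAt ℝ A q) (w : Coord m) :
    fderiv ℝ (fun z => LinearMap.trace ℝ (Coord m) (A z).toLinearMap) q w
      = LinearMap.trace ℝ (Coord m) (fderiv ℝ A q w).toLinearMap :=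
  DFunLike.congr_fun ((traceCLM m).hasFDerivAt.comp q hA.hasFDerivAt).fderiv w

namespace IsHypersurfaceOn

variable {m : ℕ} {h : Coord m → CoordForm m} {U : Set (Coord m)}
  {G : Coord (m + 1) → CoordForm (m + 1)} {Ω : Set (Coord (m + 1))}
  {F ξ : Coord m → Coord (m + 1)} {ε : ℝ} (hF : IsHypersurfaceOn h U G Ω F ξ ε) {q : Coord m}
include hF

lemma secondCovDeriv_smul_normal {f : Coord m → ℝ} (hf : ContDiffOn ℝ ∞ f U) (hq : q ∈ U)
    (u v : Coord m) :
    secondCovDeriv h G F (fun z => f z • ξ z) q u v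
      = (hessian h f q u v - ε * f q * h q (shapeOp h G F ξ q u) (shapeOp h G F ξ q v)) • ξ q
        - fderiv ℝ F q (fderiv ℝ f q v • shapeOp h G F ξ q u
          + fderiv ℝ f q u • shapeOp h G F ξ q v
          + f q • covDerivEnd h (shapeOp h G F ξ) q u v) := by
  rw [hF.secondCovDeriv_smul hf hF.contDiffOn_normal hq, hF.secondCovDeriv_normal hq,
    hF.weingarten hq, hF.weingarten hq]
  simp only [map_add, map_smul]
  module

lemma apply_laplacian_smul_normal_normal {f : Coord m → ℝ} (hf : ContDiffOn ℝ ∞ f U)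
    (hq : q ∈ U) :
    G (F q) (laplacian h G F (fun z => f z • ξ z) q) (ξ q)
      = -ε * LinearMap.trace ℝ (Coord m) ((h q).inverse ∘L hessian h f q).toLinearMap
        + f q * LinearMap.trace ℝ (Coord m)
          (shapeOp h G F ξ q ∘L shapeOp h G F ξ q).toLinearMap := by
  set A := shapeOp h G F ξ q with hA
  have hh := hF.source.isScalarProduct q hq
  have hAA (u v : Coord m) : h q (A (A u)) v = h q (A u) (A v) := by
    rw [hF.shapeOp_symm hq, hh.symm]
  have hT (u v : Coord m) : G (F q) (secondCovDeriv h G F (fun z => f z • ξ z) q u v) (ξ q)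
      = (ε • hessian h f q - f q • (h q ∘L A ∘L A)) u v := by
    rw [hF.secondCovDeriv_smul_normal hf hq]
    simp only [map_sub, map_smul, sub_apply, smul_apply, smul_eq_mul, hF.normal' hq,
      hF.unit q hq, ContinuousLinearMap.comp_apply, ← hA, hAA]
    linear_combination -f q * h q (A u) (A v) * hF.eps_mul_self
  have hraise : (h q).inverse ∘L (ε • hessian h f q - f q • (h q ∘L A ∘L A))
      = ε • ((h q).inverse ∘L hessian h f q) - f q • (A ∘L A) := by
    ext1 u
    simp [hh.inverse_apply]
  rw [hh.apply_laplacian hT, hraise]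
  simp only [ContinuousLinearMap.toLinearMap_sub, ContinuousLinearMap.toLinearMap_smul, map_sub,
    map_smul, smul_eq_mul]
  ring

lemma apply_secondCovDeriv_smul_normal_fderiv {f : Coord m → ℝ} (hf : ContDiffOn ℝ ∞ f U)
    (hq : q ∈ U) {w : Coord m}
    (hcurv : ∀ u, curvature G (F q) (fderiv ℝ F q u) (fderiv ℝ F q w) (ξ q) = 0)
    (u v : Coord m) :
    G (F q) (secondCovDeriv h G F (fun z => f z • ξ z) q u v) (fderiv ℝ F q w)
      = (-((h q (shapeOp h G F ξ q w)).smulRight (fderiv ℝ f q)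
        + (fderiv ℝ f q).smulRight (h q (shapeOp h G F ξ q w))
        + f q • (h q ∘L covDerivEnd h (shapeOp h G F ξ) q w))) u v := by
  have hdA : h q (covDerivEnd h (shapeOp h G F ξ) q u v) w
      = h q (covDerivEnd h (shapeOp h G F ξ) q w u) v := by
    rw [hF.source.apply_covDerivEnd_symm hq (hF.differentiableAt_shapeOp hq)
      fun z hz => hF.shapeOp_symm hz, hF.codazzi hq (hcurv u)]
  rw [hF.secondCovDeriv_smul_normal hf hq]
  simp only [map_sub, map_smul, map_add, sub_apply, smul_apply, add_apply, neg_apply,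
    smul_eq_mul, hF.normal q hq, hF.isometric q hq, ContinuousLinearMap.smulRight_apply,
    ContinuousLinearMap.comp_apply, hdA]
  rw [hF.shapeOp_symm hq u w, hF.shapeOp_symm hq v w]
  ring

lemma apply_laplacian_smul_normal_fderiv {f : Coord m → ℝ} (hf : ContDiffOn ℝ ∞ f U)
    (hq : q ∈ U) {w : Coord m}
    (hcurv : ∀ u, curvature G (F q) (fderiv ℝ F q u) (fderiv ℝ F q w) (ξ q) = 0) :
    G (F q) (laplacian h G F (fun z => f z • ξ z) q) (fderiv ℝ F q w)
      = 2 * fderiv ℝ f q (shapeOp h G F ξ q w) + f q * fderiv ℝ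
        (fun z => LinearMap.trace ℝ (Coord m) (shapeOp h G F ξ z).toLinearMap) q w := by
  set A := shapeOp h G F ξ q
  have hh := hF.source.isScalarProduct q hq
  have hraise : (h q).inverse ∘L (-((h q (A w)).smulRight (fderiv ℝ f q)
        + (fderiv ℝ f q).smulRight (h q (A w))
        + f q • (h q ∘L covDerivEnd h (shapeOp h G F ξ) q w)))
      = -((h q (A w)).smulRight ((h q).inverse (fderiv ℝ f q))
        + (fderiv ℝ f q).smulRight (A w) + f q • covDerivEnd h (shapeOp h G F ξ) q w) := by
    ext1 u
    simp [hh.inverse_apply]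
  rw [hh.apply_laplacian (hF.apply_secondCovDeriv_smul_normal_fderiv hf hq hcurv), hraise,
    fderiv_trace (hF.differentiableAt_shapeOp hq), ← trace_covDerivEnd (h := h)]
  simp only [ContinuousLinearMap.toLinearMap_neg, ContinuousLinearMap.toLinearMap_add,
    ContinuousLinearMap.toLinearMap_smul, map_neg, map_add, map_smul, smul_eq_mul]
  have htr (a : Coord m →L[ℝ] ℝ) (v : Coord m) :
      LinearMap.trace ℝ (Coord m) (a.smulRight v).toLinearMap = a v :=
    LinearMap.trace_smulRight a.toLinearMap v
  rw [htr, htr, hh.apply_apply_inverse]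
  ring

end IsHypersurfaceOn

section SingleEigenvalue

open Polynomial

lemma exists_charpoly_eq_pow {ι : Type*} [Fintype ι] [DecidableEq ι] {A : Matrix ι ι ℝ} {μ : ℂ}
    (hμ : {z | ((A.map (algebraMap ℝ ℂ)).charpoly).IsRoot z} = {μ}) :
    ∃ a : ℝ, A.charpoly = (X - C a) ^ Fintype.card ι := by
  have hmap : (A.map (algebraMap ℝ ℂ)).charpoly = A.charpoly.map (algebraMap ℝ ℂ) :=
    A.charpoly_map (algebraMap ℝ ℂ)
  rw [hmap] at hμ
  have hroot (z : ℂ) : (A.charpoly.map (algebraMap ℝ ℂ)).IsRoot z ↔ z = μ := Set.ext_iff.1 hμ z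
  obtain ⟨a, rfl⟩ : ∃ a : ℝ, (a : ℂ) = μ := by
    refine Complex.conj_eq_iff_real.1 ((hroot _).1 ?_) |>.imp fun a => Eq.symm
    have hzero := (hroot μ).2 rfl
    rw [IsRoot.def, eval_map_algebraMap] at hzero ⊢
    rw [Polynomial.aeval_conj, hzero, map_zero]
  refine ⟨a, Polynomial.map_injective _ (algebraMap ℝ ℂ).injective ?_⟩
  have hsplits := IsAlgClosed.splits (A.charpoly.map (algebraMap ℝ ℂ))
  have hroots : (A.charpoly.map (algebraMap ℝ ℂ)).roots
      = Multiset.replicate (Fintype.card ι) (a : ℂ) := by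
    refine Multiset.eq_replicate.2 ⟨?_, fun z hz => (hroot z).1 (mem_roots'.1 hz).2⟩
    rw [← hsplits.natDegree_eq_card_roots, A.charpoly_monic.natDegree_map,
      A.charpoly_natDegree_eq_dim]
  rw [hsplits.eq_prod_roots_of_monic (A.charpoly_monic.map _), hroots]
  simp

variable {K V : Type*} [Field K] [AddCommGroup V] [Module K V] {A : Module.End K V} {a : K}

lemma eq_zero_of_isNilpotent_sub (hA : IsNilpotent (A - algebraMap K (Module.End K V) a)) {b : K}
    (hab : a ≠ b) {L : Module.Dual K V} (hL : ∀ w, L (A w) = b * L w) : L = 0 := by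
  obtain ⟨k, hk⟩ := hA
  have hpow (k : ℕ) (w : V) :
      L (((A - algebraMap K (Module.End K V) a) ^ k) w) = (b - a) ^ k * L w := by
    induction k generalizing w with
    | zero => simp
    | succ k ih =>
      rw [pow_succ, Module.End.mul_apply, ih]
      simp only [LinearMap.sub_apply, Module.algebraMap_end_apply, map_sub, hL, map_smul,
        smul_eq_mul]
      ring
  ext w
  simpa [hk, sub_ne_zero.2 hab.symm] using hpow k w

variable [Module.Finite K V]

lemma isNilpotent_sub_of_charpoly_eq_pow {k : ℕ} (hA : A.charpoly = (X - C a) ^ k) :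
    IsNilpotent (A - algebraMap K (Module.End K V) a) :=
  ⟨k, by simpa [hA] using A.aeval_self_charpoly⟩

lemma trace_of_isNilpotent_sub (hA : IsNilpotent (A - algebraMap K (Module.End K V) a)) :
    LinearMap.trace K V A = Module.finrank K V * a := by
  have hzero := (LinearMap.isNilpotent_trace_of_isNilpotent hA).eq_zero
  rw [map_sub, sub_eq_zero, Algebra.algebraMap_eq_smul_one, map_smul, LinearMap.trace_one,
    smul_eq_mul] at hzero
  rw [hzero, mul_comm]

lemma trace_mul_self_of_isNilpotent_sub
    (hA : IsNilpotent (A - algebraMap K (Module.End K V) a)) :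
    LinearMap.trace K V (A * A) = Module.finrank K V * a ^ 2 := by
  have hcomm : Commute (A - algebraMap K (Module.End K V) a) A :=
    (Commute.refl A).sub_left (Algebra.commutes a A)
  have hzero :=
    (LinearMap.isNilpotent_trace_of_isNilpotent (hcomm.isNilpotent_mul_right hA)).eq_zero
  rw [sub_mul, map_sub, sub_eq_zero, ← Algebra.smul_def, map_smul, trace_of_isNilpotent_sub hA,
    smul_eq_mul] at hzero
  rw [hzero]
  ring

end SingleEigenvalue

namespace IsHypersurfaceOn

variable {m : ℕ} {h : Coord m → CoordForm m} {U : Set (Coord m)}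
  {G : Coord (m + 1) → CoordForm (m + 1)} {Ω : Set (Coord (m + 1))}
  {F ξ : Coord m → Coord (m + 1)} {ε lam : ℝ} (hF : IsHypersurfaceOn h U G Ω F ξ ε)
  {f : Coord m → ℝ} (hf : ContDiffOn ℝ ∞ f U)
  (htr : ∀ z ∈ U, LinearMap.trace ℝ (Coord m) (shapeOp h G F ξ z).toLinearMap = m * ε * f z)
  {q : Coord m}
include hF hf htr

lemma fderiv_apply_shapeOp (hq : q ∈ U)
    (hlap : laplacian h G F (fun z => f z • ξ z) q = lam • f q • ξ q)
    (hcurv : ∀ u v, curvature G (F q) (fderiv ℝ F q u) (fderiv ℝ F q v) (ξ q) = 0)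
    (w : Coord m) :
    fderiv ℝ f q (shapeOp h G F ξ q w) = -(m / 2) * ε * f q * fderiv ℝ f q w := by
  have htangent := hF.apply_laplacian_smul_normal_fderiv hf hq (w := w) fun u => hcurv u w
  have hnear : (fun z => LinearMap.trace ℝ (Coord m) (shapeOp h G F ξ z).toLinearMap)
      =ᶠ[nhds q] fun z => m * ε * f z :=
    Filter.eventuallyEq_of_mem (hF.source.isOpen.mem_nhds hq) htr
  rw [hlap, hnear.fderiv_eq,
    fderiv_const_mul (differentiableAt_of_contDiffOn hF.source.isOpen hf hq)] at htangent
  simp only [map_smul, smul_apply, smul_eq_mul, hF.normal q hq, mul_zero] at htangent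
  linarith

lemma fderiv_eq_zero (hq : q ∈ U)
    (hlap : laplacian h G F (fun z => f z • ξ z) q = lam • f q • ξ q)
    (hcurv : ∀ u v, curvature G (F q) (fderiv ℝ F q u) (fderiv ℝ F q v) (ξ q) = 0)
    (hsingle : IsNilpotent ((shapeOp h G F ξ q).toLinearMap
      - algebraMap ℝ (Module.End ℝ (Coord m)) (ε * f q)))
    (hfq : f q ≠ 0) : fderiv ℝ f q = 0 := by
  have hne : ε * f q ≠ -(m / 2) * ε * f q := by
    have hm : (0 : ℝ) < 1 + m / 2 := by positivity
    have hε : ε ≠ 0 := left_ne_zero_of_mul_eq_one hF.eps_mul_self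
    intro heq
    exact mul_ne_zero (mul_ne_zero hm.ne' hε) hfq (by linear_combination heq)
  refine ContinuousLinearMap.coe_injective ?_
  exact eq_zero_of_isNilpotent_sub hsingle hne (hF.fderiv_apply_shapeOp hf htr hq hlap hcurv)

theorem eq_zero_or_sq_eq [NeZero m]
    (hlap : ∀ z ∈ U, laplacian h G F (fun z => f z • ξ z) z = lam • f z • ξ z)
    (hcurv : ∀ z ∈ U, ∀ u v, curvature G (F z) (fderiv ℝ F z u) (fderiv ℝ F z v) (ξ z) = 0)
    (hsingle : ∀ z ∈ U, ∃ a : ℝ, IsNilpotent ((shapeOp h G F ξ z).toLinearMap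
      - algebraMap ℝ (Module.End ℝ (Coord m)) a))
    (hq : q ∈ U) : f q = 0 ∨ f q ^ 2 = ε * lam / m := by
  have hm : (m : ℝ) ≠ 0 := NeZero.ne _
  refine or_iff_not_imp_left.2 fun hfq => ?_
  have hU := hF.source.isOpen
  have heigen (z) (hz : z ∈ U) : IsNilpotent ((shapeOp h G F ξ z).toLinearMap
      - algebraMap ℝ (Module.End ℝ (Coord m)) (ε * f z)) := by
    obtain ⟨a, ha⟩ := hsingle z hz
    have hmean := (htr z hz).symm.trans (trace_of_isNilpotent_sub ha)
    rw [finrank_euclideanSpace_fin, mul_assoc] at hmean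
    rwa [mul_left_cancel₀ hm hmean]
  have hcrit : fderiv ℝ f =ᶠ[nhds q] fun _ => 0 := by
    filter_upwards [hU.mem_nhds hq,
      (hf.continuousOn.continuousAt (hU.mem_nhds hq)).eventually_ne hfq] with z hz hfz
    exact hF.fderiv_eq_zero hf htr hz (hlap z hz) (hcurv z hz) (heigen z hz) hfz
  have hhess : hessian h f q = 0 := by
    rw [hessian, hcrit.fderiv_eq, hcrit.self_of_nhds]
    simp
  have htr2 := trace_mul_self_of_isNilpotent_sub (heigen q hq)
  have hnormal := hF.apply_laplacian_smul_normal_normal hf hq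
  rw [hlap q hq, hhess, ContinuousLinearMap.toLinearMap_comp (shapeOp h G F ξ q),
    ← Module.End.mul_eq_comp, htr2] at hnormal
  simp only [map_smul, smul_apply, smul_eq_mul, hF.unit q hq, finrank_euclideanSpace_fin,
    ContinuousLinearMap.comp_zero, ContinuousLinearMap.toLinearMap_zero, map_zero, mul_zero,
    zero_add] at hnormal
  rw [eq_div_iff hm]
  refine mul_left_cancel₀ hfq ?_
  linear_combination -hnormal - f q ^ 3 * m * hF.eps_mul_self

end IsHypersurfaceOn

section ChangeOfCoordinates

lemma charpoly_eq_of_comp_eq {K V : Type*} [Field K] [AddCommGroup V] [Module K V]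
    [FiniteDimensional K V] {A A' k : Module.End K V} (hk : Function.Injective k)
    (hcomp : k ∘ₗ A' = A ∘ₗ k) : A'.charpoly = A.charpoly := by
  let e := LinearEquiv.ofInjectiveEndo k hk
  have hconj : e.conj A' = A := (LinearEquiv.comp_toLinearMap_symm_eq _ _).2 hcomp
  rw [← hconj, LinearEquiv.charpoly_conj]

namespace IsIsometricImmersionOn

variable {m n : ℕ} {h h' : Coord m → CoordForm m} {U U' : Set (Coord m)}
  {G G' : Coord n → CoordForm n} {Ω Ω' Z Z' : Set (Coord n)}
  {F F' ξ ξ' : Coord m → Coord n} {θ : Coord n → Coord n} {κ : Coord m → Coord m} {q : Coord m}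
  (hF : IsIsometricImmersionOn h U G Ω F) (hθ : IsIsometricImmersionOn G Z G' Z' θ)
  (hκ : DifferentiableAt ℝ κ q) (hκq : κ q ∈ U) (hFκq : F (κ q) ∈ Z)
  (hFθ : F' =ᶠ[nhds q] fun z => θ (F (κ z)))
include hF hθ hκ hκq hFκq hFθ

lemma fderiv_change_apply (u : Coord m) :
    fderiv ℝ F' q u = fderiv ℝ θ (F (κ q)) (fderiv ℝ F (κ q) (fderiv ℝ κ q u)) := by
  have hFκ := hF.differentiableAt hκq
  have hcomp : DifferentiableAt ℝ (fun z => F (κ z)) q := hFκ.comp q hκ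
  rw [hFθ.fderiv_eq, fderiv_fun_comp q (hθ.differentiableAt hFκq) hcomp,
    fderiv_fun_comp q hFκ hκ, ContinuousLinearMap.comp_apply, ContinuousLinearMap.comp_apply]

variable (hF' : IsIsometricImmersionOn h' U' G' Ω' F') (hq : q ∈ U')
include hF' hq

lemma apply_fderiv_change (u v : Coord m) :
    h (κ q) (fderiv ℝ κ q u) (fderiv ℝ κ q v) = h' q u v := by
  have hchange := hF.fderiv_change_apply hθ hκ hκq hFκq hFθ
  rw [← hF'.isometric q hq, ← hF.isometric _ hκq, ← hθ.isometric _ hFκq, hFθ.self_of_nhds,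
    hchange, hchange]

lemma injective_fderiv_change : Function.Injective (fderiv ℝ κ q) := fun u v huv =>
  (hF'.source.isScalarProduct q hq).eq_of_forall fun w => by
    rw [← hF.apply_fderiv_change hθ hκ hκq hFκq hFθ hF' hq,
      ← hF.apply_fderiv_change hθ hκ hκq hFκq hFθ hF' hq, huv]

variable (hξ : DifferentiableAt ℝ ξ (κ q))
  (hξθ : ξ' =ᶠ[nhds q] fun z => fderiv ℝ θ (F (κ z)) (ξ (κ z)))
include hξ hξθ

lemma fderiv_change_shapeOp (u : Coord m) :
    fderiv ℝ κ q (shapeOp h' G' F' ξ' q u) = shapeOp h G F ξ (κ q) (fderiv ℝ κ q u) := by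
  have hFκ := hF.differentiableAt hκq
  have hξκ : DifferentiableAt ℝ (fun z => ξ (κ z)) q := hξ.comp q hκ
  refine (hF.source.isScalarProduct _ hκq).eq_of_forall fun w' => ?_
  obtain ⟨w, rfl⟩ := LinearMap.surjective_of_injective (f := (fderiv ℝ κ q).toLinearMap)
    (hF.injective_fderiv_change hθ hκ hκq hFκq hFθ hF' hq) w'
  rw [ContinuousLinearMap.coe_coe, hF.apply_fderiv_change hθ hκ hκq hFκq hFθ hF' hq,
    hF'.apply_shapeOp hq, hF.apply_shapeOp hκq, covDeriv_congr hFθ hξθ,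
    hθ.covDeriv_map (F := fun z => F (κ z)) (hFκ.comp q hκ) hξκ hFκq,
    covDeriv_comp hκ hFκ hξ, hF.fderiv_change_apply hθ hκ hκq hFκq hFθ, hFθ.self_of_nhds,
    hθ.isometric _ hFκq]

lemma charpoly_shapeOp_change : (shapeOp h' G' F' ξ' q).toLinearMap.charpoly
    = (shapeOp h G F ξ (κ q)).toLinearMap.charpoly := by
  refine charpoly_eq_of_comp_eq (k := (fderiv ℝ κ q).toLinearMap)
    (hF.injective_fderiv_change hθ hκ hκq hFκq hFθ hF' hq) (LinearMap.ext fun u => ?_)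
  rw [LinearMap.comp_apply, LinearMap.comp_apply]
  exact hF.fderiv_change_shapeOp hθ hκ hκq hFκq hFθ hF' hq hξ hξθ u

end IsIsometricImmersionOn

end ChangeOfCoordinates

section LocalExpressions

variable {m n : ℕ} {M : Type*} [TopologicalSpace M] {N : Type*} [TopologicalSpace N]
  {φ : OpenPartialHomeomorph M (Coord m)} {ψ : OpenPartialHomeomorph N (Coord n)} {x : M → N}

/-- The domain of the coordinate expression `coordMap φ ψ x` of a map `x`. -/
def coordDomain (φ : OpenPartialHomeomorph M (Coord m)) (ψ : OpenPartialHomeomorph N (Coord n))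
    (x : M → N) : Set (Coord m) :=
  φ.target ∩ φ.symm ⁻¹' (x ⁻¹' ψ.source)

lemma mem_coordDomain {p : M} (hp : p ∈ φ.source) (hxp : x p ∈ ψ.source) :
    φ p ∈ coordDomain φ ψ x :=
  ⟨φ.map_source hp, by rwa [Set.mem_preimage, φ.left_inv hp]⟩

lemma isOpen_coordDomain (hx : Continuous x) : IsOpen (coordDomain φ ψ x) :=
  φ.isOpen_inter_preimage_symm (ψ.open_source.preimage hx)

lemma coordField_smul [ChartedSpace (Coord n) N] {ξ : ∀ p : M, TangentSpace (𝓡 n) (x p)}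
    (f : M → ℝ) (q : Coord m) :
    coordField φ ψ x (fun p => f p • ξ p) q = f (φ.symm q) • coordField φ ψ x ξ q :=
  map_smul (mfderiv (𝓡 n) (𝓡 n) ψ (x (φ.symm q))) (f (φ.symm q)) (ξ (φ.symm q))

end LocalExpressions

section Charts

variable {m n : ℕ}
  {M : Type*} [TopologicalSpace M] [ChartedSpace (Coord m) M] [IsManifold (𝓡 m) ∞ M]
  {N : Type*} [TopologicalSpace N] [ChartedSpace (Coord n) N] [IsManifold (𝓡 n) ∞ N]
  {φ : OpenPartialHomeomorph M (Coord m)} {ψ ψ' : OpenPartialHomeomorph N (Coord n)}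
  {x : M → N} {g : Metric n N} {ξ : ∀ p : M, TangentSpace (𝓡 n) (x p)}

lemma contMDiffOn_of_mem_atlas (hψ : ψ ∈ atlas (Coord n) N) :
    ContMDiffOn (𝓡 n) (𝓡 n) ∞ ψ ψ.source :=
  contMDiffOn_of_mem_maximalAtlas (IsManifold.subset_maximalAtlas hψ)

lemma contMDiffOn_symm_of_mem_atlas (hψ : ψ ∈ atlas (Coord n) N) :
    ContMDiffOn (𝓡 n) (𝓡 n) ∞ ψ.symm ψ.target :=
  contMDiffOn_symm_of_mem_maximalAtlas (IsManifold.subset_maximalAtlas hψ)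

lemma coordForm_mfderiv (hψ : ψ ∈ atlas (Coord n) N)
    (b : ∀ p : N, TangentSpace (𝓡 n) p →L[ℝ] TangentSpace (𝓡 n) p →L[ℝ] ℝ) {p : N}
    (hp : p ∈ ψ.source) (u v : TangentSpace (𝓡 n) p) :
    coordForm ψ b (ψ p) (mfderiv (𝓡 n) (𝓡 n) ψ p u) (mfderiv (𝓡 n) (𝓡 n) ψ p v) = b p u v := by
  have hsymm (w : Coord n) :
      (mfderiv (𝓡 n) (𝓡 n) ψ.symm (ψ p) (mfderiv (𝓡 n) (𝓡 n) ψ p w : Coord n) : Coord n) = w :=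
    DFunLike.congr_fun ((mdifferentiable_of_mem_atlas hψ).symm_comp_deriv hp) w
  -- `TangentSpace` is a constant family, so vectors can be compared at `ψ.symm (ψ p)` and at `p`
  have htransport : ∀ z : N, z = p → ∀ u' v' : Coord n, u' = u → v' = v →
      b z (u' : TangentSpace (𝓡 n) z) (v' : TangentSpace (𝓡 n) z) = b p u v := by
    rintro z rfl u' v' rfl rfl
    rfl
  exact htransport _ (ψ.left_inv hp) _ _ (hsymm u) (hsymm v)

lemma contMDiffOn_symm_tangent (hψ : ψ ∈ atlas (Coord n) N) (w : Coord n) :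
    ContMDiffOn (𝓡 n) (𝓡 n).tangent ∞
      (fun y => (⟨ψ.symm y, mfderiv (𝓡 n) (𝓡 n) ψ.symm y w⟩ : TangentBundle (𝓡 n) N))
      ψ.target := by
  have hconst : ContMDiffOn (𝓡 n) (𝓡 n).tangent ∞
      (fun y : Coord n => (⟨y, w⟩ : TangentBundle (𝓡 n) (Coord n))) ψ.target := fun y _ =>
    contMDiffWithinAt_vectorSpace_iff_contDiffWithinAt.2 contDiffWithinAt_const
  have htangent := (contMDiffOn_symm_of_mem_atlas hψ).contMDiffOn_tangentMapWithin (m := ∞) le_rfl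
    ψ.open_target.uniqueMDiffOn
  refine (htangent.comp hconst fun y hy => hy).congr fun y hy => ?_
  simp only [Function.comp, tangentMapWithin,
    mfderivWithin_of_mem_nhds (ψ.open_target.mem_nhds hy)]

lemma contDiffOn_coordForm (hψ : ψ ∈ atlas (Coord n) N) :
    ContDiffOn ℝ ∞ (coordForm ψ g.val) ψ.target := by
  refine contDiffOn_clm_apply.2 fun u => contDiffOn_clm_apply.2 fun v => ?_
  have hmetric : ContMDiffOn (𝓡 n) ((𝓡 n).prod 𝓘(ℝ, CoordForm n)) ∞
      (fun y => TotalSpace.mk' (CoordForm n) (E := fun p : N => TangentSpace (𝓡 n) p →L[ℝ]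
        TangentSpace (𝓡 n) p →L[ℝ] ℝ) (ψ.symm y) (g.val (ψ.symm y))) ψ.target :=
    g.contMDiff.comp_contMDiffOn (contMDiffOn_symm_of_mem_atlas hψ)
  have happly := ContMDiffOn.clm_bundle_apply₂ (F₁ := Coord n) (F₂ := Coord n) (F₃ := ℝ)
    (E₃ := Bundle.Trivial N ℝ) hmetric (contMDiffOn_symm_tangent hψ u)
    (contMDiffOn_symm_tangent hψ v)
  exact contMDiffOn_iff_contDiffOn.1 fun y hy => (contMDiffWithinAt_totalSpace.1 (happly y hy)).2

lemma coordForm_nondegenerate (hψ : ψ ∈ atlas (Coord n) N)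
    {b : ∀ p : N, TangentSpace (𝓡 n) p →L[ℝ] TangentSpace (𝓡 n) p →L[ℝ] ℝ} {y : Coord n}
    (hy : y ∈ ψ.target) (hb : ∀ u, (∀ v, b (ψ.symm y) u v = 0) → u = 0) (u : Coord n)
    (hu : ∀ v, coordForm ψ b y u v = 0) : u = 0 := by
  have hbij := (mdifferentiable_of_mem_atlas hψ : ψ.MDifferentiable (𝓡 n) (𝓡 n)).symm
    |>.mfderiv_bijective hy
  refine hbij.1 ((hb _ fun w => ?_).trans (map_zero _).symm)
  obtain ⟨v, rfl⟩ := hbij.2 w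
  exact hu v

lemma isPseudoMetricOn_coordForm (hψ : ψ ∈ atlas (Coord n) N) :
    IsPseudoMetricOn (coordForm ψ g.val) ψ.target where
  isOpen := ψ.open_target
  contDiffOn := contDiffOn_coordForm hψ
  isScalarProduct _ hy :=
    { symm := fun _ _ => g.symm _ _ _
      nondegenerate := coordForm_nondegenerate hψ hy (g.nondegenerate _) }

lemma contDiffOn_coordMap (hφ : φ ∈ atlas (Coord m) M) (hψ : ψ ∈ atlas (Coord n) N)
    (hx : ContMDiff (𝓡 m) (𝓡 n) ∞ x) :
    ContDiffOn ℝ ∞ (coordMap φ ψ x) (coordDomain φ ψ x) :=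
  contMDiffOn_iff_contDiffOn.1 <| (contMDiffOn_of_mem_atlas hψ).comp (hx.comp_contMDiffOn
    ((contMDiffOn_symm_of_mem_atlas hφ).mono Set.inter_subset_left)) fun _ hq => hq.2

lemma fderiv_coordMap (hφ : φ ∈ atlas (Coord m) M) (hψ : ψ ∈ atlas (Coord n) N)
    (hx : ContMDiff (𝓡 m) (𝓡 n) ∞ x) {q : Coord m} (hq : q ∈ coordDomain φ ψ x) (u : Coord m) :
    fderiv ℝ (coordMap φ ψ x) q u = mfderiv (𝓡 n) (𝓡 n) ψ (x (φ.symm q))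
      (mfderiv (𝓡 m) (𝓡 n) x (φ.symm q) (mfderiv (𝓡 m) (𝓡 m) φ.symm q u)) := by
  have hφq :=
    ((mdifferentiable_of_mem_atlas (I := 𝓡 m) hφ).mdifferentiableAt_symm hq.1).hasMFDerivAt
  have hxq := ((hx (φ.symm q)).mdifferentiableAt (by simp)).hasMFDerivAt
  have hψq := ((mdifferentiable_of_mem_atlas (I := 𝓡 n) hψ).mdifferentiableAt hq.2).hasMFDerivAt
  rw [← mfderiv_eq_fderiv]
  exact DFunLike.congr_fun (hψq.comp q (hxq.comp q hφq)).mfderiv u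

lemma contDiffOn_coordField (hφ : φ ∈ atlas (Coord m) M) (hψ : ψ ∈ atlas (Coord n) N)
    (hξ : ContMDiff (𝓡 m) (𝓡 n).tangent ∞ (fun p => (⟨x p, ξ p⟩ : TangentBundle (𝓡 n) N))) :
    ContDiffOn ℝ ∞ (coordField φ ψ x ξ) (coordDomain φ ψ x) := by
  have htangent := (contMDiffOn_of_mem_atlas hψ).contMDiffOn_tangentMapWithin (m := ∞) le_rfl
    ψ.open_source.uniqueMDiffOn
  have hcomp := hξ.comp_contMDiffOn ((contMDiffOn_symm_of_mem_atlas hφ).mono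
    (Set.inter_subset_left : coordDomain φ ψ x ⊆ _))
  have hsnd := (contMDiff_snd_tangentBundle_modelSpace (Coord n) (𝓡 n) (n := ∞)).comp_contMDiffOn
    (htangent.comp hcomp fun q hq => hq.2)
  refine contMDiffOn_iff_contDiffOn.1 (hsnd.congr fun q hq => ?_)
  simp only [Function.comp, tangentMapWithin,
    mfderivWithin_of_mem_nhds (ψ.open_source.mem_nhds hq.2)]
  rfl

lemma isIsometricImmersionOn_coordMap (hφ : φ ∈ atlas (Coord m) M) (hψ : ψ ∈ atlas (Coord n) N)
    (hx : ContMDiff (𝓡 m) (𝓡 n) ∞ x)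
    (hnondeg : ∀ (p : M) (u : TangentSpace (𝓡 m) p),
      (∀ v, inducedForm g.val x p u v = 0) → u = 0) :
    IsIsometricImmersionOn (coordForm φ (inducedForm g.val x)) (coordDomain φ ψ x)
      (coordForm ψ g.val) ψ.target (coordMap φ ψ x) :=
  .of_nondegenerate (isOpen_coordDomain hx.continuous) (isPseudoMetricOn_coordForm hψ)
    (fun _ hq => ψ.map_source hq.2) (contDiffOn_coordMap hφ hψ hx)
    (fun q hq u v => by
      rw [fderiv_coordMap hφ hψ hx hq, fderiv_coordMap hφ hψ hx hq, coordMap,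
        coordForm_mfderiv hψ g.val hq.2]
      rfl)
    fun q hq => coordForm_nondegenerate hφ hq.1 (hnondeg _)

lemma isHypersurfaceOn_coordMap {r : ℕ} {ε : ℝ} (hφ : φ ∈ atlas (Coord m) M)
    (hψ : ψ ∈ atlas (Coord n) N) (hx : IsNondegenerateImmersion m g x r)
    (hξ : IsUnitNormal m g x ξ ε) (hε : ε = 1 ∨ ε = -1) :
    IsHypersurfaceOn (coordForm φ (inducedForm g.val x)) (coordDomain φ ψ x)
      (coordForm ψ g.val) ψ.target (coordMap φ ψ x) (coordField φ ψ x ξ) ε where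
  __ := isIsometricImmersionOn_coordMap hφ hψ hx.contMDiff hx.nondegenerate
  contDiffOn_normal := contDiffOn_coordField hφ hψ hξ.contMDiff
  normal q hq v := by
    rw [fderiv_coordMap hφ hψ hx.contMDiff hq, coordMap, coordField,
      coordForm_mfderiv hψ g.val hq.2]
    exact hξ.normal _ _
  unit q hq := by
    rw [coordMap, coordField, coordForm_mfderiv hψ g.val hq.2]
    exact hξ.unit _
  eps_mul_self := mul_self_eq_one_iff.2 hε

lemma inducedForm_id : inducedForm g.val (id : N → N) = g.val := by
  funext p
  rw [inducedForm, mfderiv_id]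
  rfl

lemma isIsometricImmersionOn_coordMap_id (hψ : ψ ∈ atlas (Coord n) N)
    (hψ' : ψ' ∈ atlas (Coord n) N) :
    IsIsometricImmersionOn (coordForm ψ g.val) (coordDomain ψ ψ' (id : N → N))
      (coordForm ψ' g.val) ψ'.target (coordMap ψ ψ' id) := by
  have hid := isIsometricImmersionOn_coordMap (g := g) hψ hψ' contMDiff_id
    (by rw [inducedForm_id]; exact g.nondegenerate)
  rwa [inducedForm_id] at hid

lemma fderiv_coordMap_id_mfderiv (hψ : ψ ∈ atlas (Coord n) N) (hψ' : ψ' ∈ atlas (Coord n) N)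
    {p : N} (hp : p ∈ ψ.source) (hp' : p ∈ ψ'.source) (v : TangentSpace (𝓡 n) p) :
    fderiv ℝ (coordMap ψ ψ' id) (ψ p) (mfderiv (𝓡 n) (𝓡 n) ψ p v)
      = mfderiv (𝓡 n) (𝓡 n) ψ' p v := by
  have hψp := ((mdifferentiable_of_mem_atlas (I := 𝓡 n) hψ).mdifferentiableAt hp).hasMFDerivAt
  have htransition := (differentiableAt_of_contDiffOn (isOpen_coordDomain continuous_id)
    (contDiffOn_coordMap hψ hψ' contMDiff_id) (mem_coordDomain hp hp')).hasFDerivAt.hasMFDerivAt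
  have hnear : ψ' =ᶠ[nhds p] coordMap ψ ψ' id ∘ ψ := by
    filter_upwards [ψ.open_source.mem_nhds hp] with z hz
    simp [coordMap, ψ.left_inv hz]
  exact (DFunLike.congr_fun ((htransition.comp p hψp).congr_of_eventuallyEq hnear).mfderiv v).symm

end Charts

section MeanCurvature

variable {m n : ℕ}
  {M : Type*} [TopologicalSpace M] [ChartedSpace (Coord m) M]
  {N : Type*} [TopologicalSpace N] [ChartedSpace (Coord n) N]

/-- The shape operator `A` of `x` associated with `ξ`, read in the charts `φ` and `ψ` at the point
with coordinates `q`, as an endomorphism of the coordinate space of `φ`. -/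
noncomputable def coordShapeOp (φ : OpenPartialHomeomorph M (Coord m))
    (ψ : OpenPartialHomeomorph N (Coord n)) [IsManifold (𝓡 n) ∞ N] (g : Metric n N) (x : M → N)
    (ξ : ∀ p : M, TangentSpace (𝓡 n) (x p)) (q : Coord m) : Coord m →L[ℝ] Coord m :=
  shapeOp (coordForm φ (inducedForm g.val x)) (coordForm ψ g.val) (coordMap φ ψ x)
    (coordField φ ψ x ξ) q

variable {φ φ' : OpenPartialHomeomorph M (Coord m)} {ψ ψ' : OpenPartialHomeomorph N (Coord n)}
  {x : M → N} {ξ : ∀ p : M, TangentSpace (𝓡 n) (x p)}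

variable [IsManifold (𝓡 m) ∞ M] [IsManifold (𝓡 n) ∞ N] {g : Metric n N} {r : ℕ} {ε : ℝ}
  (hx : IsNondegenerateImmersion m g x r)
  (hξ : ContMDiff (𝓡 m) (𝓡 n).tangent ∞ (fun p => (⟨x p, ξ p⟩ : TangentBundle (𝓡 n) N)))
  (hφ : φ ∈ atlas (Coord m) M) (hψ : ψ ∈ atlas (Coord n) N)
include hx hξ hφ hψ

lemma charpoly_coordShapeOp (hφ' : φ' ∈ atlas (Coord m) M) (hψ' : ψ' ∈ atlas (Coord n) N) {p : M}
    (hp : p ∈ φ.source) (hp' : p ∈ φ'.source) (hxp : x p ∈ ψ.source) (hxp' : x p ∈ ψ'.source) :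
    (coordShapeOp φ' ψ' g x ξ (φ' p)).toLinearMap.charpoly
      = (coordShapeOp φ ψ g x ξ (φ p)).toLinearMap.charpoly := by
  have hxc := hx.contMDiff.continuous
  have hκ : coordMap φ' φ id (φ' p) = φ p := by simp [coordMap, φ'.left_inv hp']
  have hFp : coordMap φ ψ x (φ p) = ψ (x p) := by simp [coordMap, φ.left_inv hp]
  have hnear : ∀ᶠ z in nhds (φ' p), φ'.symm z ∈ φ.source ∩ x ⁻¹' (ψ.source ∩ ψ'.source) :=
    (φ'.continuousAt_symm (φ'.map_source hp')).eventually_mem <|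
      (φ.open_source.inter ((ψ.open_source.inter ψ'.open_source).preimage hxc)).mem_nhds <| by
        rw [φ'.left_inv hp']
        exact ⟨hp, hxp, hxp'⟩
  have hpq : coordMap φ' φ id (φ' p) ∈ coordDomain φ ψ x := hκ ▸ mem_coordDomain hp hxp
  rw [← hκ]
  have hF := isIsometricImmersionOn_coordMap hφ hψ hx.contMDiff hx.nondegenerate
  refine hF.charpoly_shapeOp_change
    (isIsometricImmersionOn_coordMap_id hψ hψ')
    (differentiableAt_of_contDiffOn (isOpen_coordDomain continuous_id)
      (contDiffOn_coordMap hφ' hφ contMDiff_id) (mem_coordDomain hp' hp)) hpq ?_ ?_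
    (isIsometricImmersionOn_coordMap hφ' hψ' hx.contMDiff hx.nondegenerate)
    (mem_coordDomain hp' hxp')
    (differentiableAt_of_contDiffOn (isOpen_coordDomain hxc) (contDiffOn_coordField hφ hψ hξ) hpq)
    ?_
  · rw [hκ, hFp]
    exact mem_coordDomain hxp hxp'
  · filter_upwards [hnear] with z ⟨hz, hxz, _⟩
    simp [coordMap, φ.left_inv hz, ψ.left_inv hxz]
  · filter_upwards [hnear] with z ⟨hz, hxz, hxz'⟩
    have hfoot : coordMap φ ψ x (coordMap φ' φ id z) = ψ (x (φ'.symm z)) := by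
      simp [coordMap, φ.left_inv hz]
    have hfield : coordField φ ψ x ξ (coordMap φ' φ id z)
        = mfderiv (𝓡 n) (𝓡 n) ψ (x (φ'.symm z)) (ξ (φ'.symm z)) :=
      congrArg (fun p => (mfderiv (𝓡 n) (𝓡 n) ψ (x p) (ξ p) : Coord n)) (φ.left_inv hz)
    rw [hfoot, hfield]
    exact (fderiv_coordMap_id_mfderiv hψ hψ' hxz hxz' _).symm

variable {q : Coord m} (hq : q ∈ coordDomain φ ψ x)
include hq

lemma charpoly_shapeOperator : (shapeOperator (m := m) g x ξ (φ.symm q)).charpoly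
    = (coordShapeOp φ ψ g x ξ q).toLinearMap.charpoly := by
  have hchange := charpoly_coordShapeOp hx hξ hφ hψ (chart_mem_atlas (Coord m) (φ.symm q))
    (chart_mem_atlas (Coord n) (x (φ.symm q))) (φ.map_target hq.1) (mem_chart_source _ _) hq.2
    (mem_chart_source _ _)
  rw [φ.right_inv hq.1] at hchange
  rw [← hchange, shapeOperator, (isIsometricImmersionOn_coordMap (chart_mem_atlas _ _)
    (chart_mem_atlas _ _) hx.contMDiff hx.nondegenerate).shapeMatrix_eq_toMatrix
    (mem_coordDomain (mem_chart_source _ _) (mem_chart_source _ _)),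
    LinearMap.charpoly_toMatrix]
  rfl

lemma meanCurvature_symm : meanCurvature (m := m) g x ξ ε (φ.symm q)
    = 1 / m * ε * LinearMap.trace ℝ (Coord m) (coordShapeOp φ ψ g x ξ q).toLinearMap := by
  rw [meanCurvature, Matrix.trace_eq_neg_charpoly_nextCoeff,
    charpoly_shapeOperator hx hξ hφ hψ hq,
    LinearMap.trace_eq_matrix_trace ℝ (EuclideanSpace.basisFun (Fin m) ℝ).toBasis,
    Matrix.trace_eq_neg_charpoly_nextCoeff, LinearMap.charpoly_toMatrix]

omit hq in
lemma contDiffOn_meanCurvature_symm :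
    ContDiffOn ℝ ∞ (fun q => meanCurvature (m := m) g x ξ ε (φ.symm q)) (coordDomain φ ψ x) := by
  have hshape : ContDiffOn ℝ ∞ (coordShapeOp φ ψ g x ξ) (coordDomain φ ψ x) :=
    (isIsometricImmersionOn_coordMap hφ hψ hx.contMDiff hx.nondegenerate).contDiffOn_shapeOp
      (contDiffOn_coordField hφ hψ hξ)
  exact (contDiffOn_const.mul ((traceCLM m).contDiff.comp_contDiffOn hshape)).congr
    fun q hq => meanCurvature_symm hx hξ hφ hψ hq

omit hφ hψ hq in
lemma continuous_meanCurvature : Continuous (meanCurvature (m := m) g x ξ ε) := by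
  refine continuous_iff_continuousAt.2 fun p => ?_
  have hp := mem_coordDomain (x := x) (mem_chart_source (Coord m) p)
    (mem_chart_source (Coord n) (x p))
  refine ((chartAt (Coord m) p).symm.continuousAt_iff_continuousAt_comp_right
    (mem_chart_source (Coord m) p)).2 ?_
  exact (contDiffOn_meanCurvature_symm hx hξ (chart_mem_atlas _ _)
    (chart_mem_atlas _ _)).continuousOn.continuousAt
      ((isOpen_coordDomain hx.contMDiff.continuous).mem_nhds hp)

end MeanCurvature

section SinglePrincipalCurvature

/-- The hypersurface `x : M → N` with normal field `ξ` is curvature-invariant: the curvature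
operators `R(X, Y)` of `N`, for `X` and `Y` tangent to `M`, preserve the tangent spaces of `M`. This
is expressed in local coordinates, in the equivalent form `R(X, Y) ξ = 0`. -/
def IsCurvatureInvariant {m n : ℕ} {M : Type*} [TopologicalSpace M] [ChartedSpace (Coord m) M]
    {N : Type*} [TopologicalSpace N] [ChartedSpace (Coord n) N] [IsManifold (𝓡 n) ∞ N]
    (g : Metric n N) (x : M → N) (ξ : ∀ p : M, TangentSpace (𝓡 n) (x p)) : Prop :=
  ∀ φ ∈ atlas (Coord m) M, ∀ ψ ∈ atlas (Coord n) N, ∀ q ∈ coordDomain φ ψ x, ∀ u v : Coord m,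
    curvature (coordForm ψ g.val) (coordMap φ ψ x q) (fderiv ℝ (coordMap φ ψ x) q u)
      (fderiv ℝ (coordMap φ ψ x) q v) (coordField φ ψ x ξ q) = 0

variable {m n : ℕ}
  {M : Type*} [TopologicalSpace M] [ChartedSpace (Coord m) M]

lemma laplacian_coordField_of_laplacianEq {N : Type*} [TopologicalSpace N]
    [ChartedSpace (Coord n) N] [IsManifold (𝓡 n) ∞ N] {g : Metric n N} {x : M → N}
    {ξ : ∀ p : M, TangentSpace (𝓡 n) (x p)} {f : M → ℝ} {lam : ℝ}
    (hlap : LaplacianEq m g x (fun p => f p • ξ p) (fun p => lam • f p • ξ p))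
    {φ : OpenPartialHomeomorph M (Coord m)} {ψ : OpenPartialHomeomorph N (Coord n)}
    (hφ : φ ∈ atlas (Coord m) M) (hψ : ψ ∈ atlas (Coord n) N) {q : Coord m}
    (hq : q ∈ coordDomain φ ψ x) :
    laplacian (coordForm φ (inducedForm g.val x)) (coordForm ψ g.val) (coordMap φ ψ x)
      (fun q => f (φ.symm q) • coordField φ ψ x ξ q) q
        = lam • f (φ.symm q) • coordField φ ψ x ξ q := by
  have hlapq := hlap φ hφ ψ hψ q hq.1 hq.2
  rwa [coordField_smul (fun _ => lam), coordField_smul f, funext (coordField_smul f)] at hlapq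

variable [IsManifold (𝓡 m) ∞ M]

lemma IsSpaceForm.isCurvatureInvariant {N : Type*} [TopologicalSpace N]
    [ChartedSpace (Coord n) N] [IsManifold (𝓡 n) ∞ N] {g : Metric n N} {s r : ℕ} {c ε : ℝ}
    (hN : IsSpaceForm g s c) {x : M → N} (hx : IsNondegenerateImmersion m g x r)
    {ξ : ∀ p : M, TangentSpace (𝓡 n) (x p)} (hξ : IsUnitNormal m g x ξ ε)
    (hε : ε = 1 ∨ ε = -1) : IsCurvatureInvariant (m := m) g x ξ := by
  intro φ hφ ψ hψ q hq u v
  have hF := isHypersurfaceOn_coordMap hφ hψ hx hξ hε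
  rw [hN.curvature_eq ψ hψ _ (hF.mapsTo hq), hF.normal' hq, hF.normal' hq]
  simp

section Charts

variable {N : Type*} [TopologicalSpace N] [ChartedSpace (Coord n) N] [IsManifold (𝓡 n) ∞ N]
  {g : Metric n N} {r : ℕ} {x : M → N} (hx : IsNondegenerateImmersion m g x r)
  {ξ : ∀ p : M, TangentSpace (𝓡 n) (x p)}
  (hξ : ContMDiff (𝓡 m) (𝓡 n).tangent ∞ (fun p => (⟨x p, ξ p⟩ : TangentBundle (𝓡 n) N)))
  {φ : OpenPartialHomeomorph M (Coord m)} {ψ : OpenPartialHomeomorph N (Coord n)}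
  (hφ : φ ∈ atlas (Coord m) M) (hψ : ψ ∈ atlas (Coord n) N) {q : Coord m}
  (hq : q ∈ coordDomain φ ψ x)
include hx hξ hφ hψ hq

lemma trace_coordShapeOp [NeZero m] {ε : ℝ} (hε : ε = 1 ∨ ε = -1) :
    LinearMap.trace ℝ (Coord m) (coordShapeOp φ ψ g x ξ q).toLinearMap
      = m * ε * meanCurvature (m := m) g x ξ ε (φ.symm q) := by
  have hm : (m : ℝ) ≠ 0 := NeZero.ne _
  rw [meanCurvature_symm hx hξ hφ hψ hq]
  rcases hε with rfl | rfl <;> field_simp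

lemma exists_isNilpotent_coordShapeOp_sub {μ : ℂ}
    (hμ : principalCurvatures (m := m) g x ξ (φ.symm q) = {μ}) :
    ∃ a : ℝ, IsNilpotent
      ((coordShapeOp φ ψ g x ξ q).toLinearMap - algebraMap ℝ (Module.End ℝ (Coord m)) a) := by
  obtain ⟨a, ha⟩ := exists_charpoly_eq_pow hμ
  rw [charpoly_shapeOperator hx hξ hφ hψ hq] at ha
  exact ⟨a, isNilpotent_sub_of_charpoly_eq_pow ha⟩

end Charts

lemma meanCurvature_eq_zero_or_sq_eq [NeZero m] {N : Type*} [TopologicalSpace N]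
    [ChartedSpace (Coord (m + 1)) N] [IsManifold (𝓡 (m + 1)) ∞ N] {g : Metric (m + 1) N} {r : ℕ}
    {lam ε : ℝ} {x : M → N} (hx : IsNondegenerateImmersion m g x r)
    {ξ : ∀ p : M, TangentSpace (𝓡 (m + 1)) (x p)} (hε : ε = 1 ∨ ε = -1)
    (hξ : IsUnitNormal m g x ξ ε) (hR : IsCurvatureInvariant (m := m) g x ξ)
    (hproper : LaplacianEq m g x (meanCurvatureVector (m := m) g x ξ ε)
      (fun p => lam • meanCurvatureVector (m := m) g x ξ ε p))
    (hcurv : ∀ p : M, ∃ μ : ℂ, principalCurvatures (m := m) g x ξ p = {μ}) (p : M) :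
    meanCurvature (m := m) g x ξ ε p = 0 ∨
      meanCurvature (m := m) g x ξ ε p ^ 2 = ε * lam / m := by
  have hφ := chart_mem_atlas (Coord m) p
  have hψ := chart_mem_atlas (Coord (m + 1)) (x p)
  rw [← (chartAt (Coord m) p).left_inv (mem_chart_source (Coord m) p)]
  exact (isHypersurfaceOn_coordMap hφ hψ hx hξ hε).eq_zero_or_sq_eq
    (contDiffOn_meanCurvature_symm hx hξ.contMDiff hφ hψ)
    (fun _ hq => trace_coordShapeOp hx hξ.contMDiff hφ hψ hq hε)
    (fun _ hq => laplacian_coordField_of_laplacianEq hproper hφ hψ hq)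
    (hR _ hφ _ hψ)
    (fun _ hq => (hcurv _).elim fun _ =>
      exists_isNilpotent_coordShapeOp_sub hx hξ.contMDiff hφ hψ hq)
    (mem_coordDomain (mem_chart_source _ p) (mem_chart_source _ (x p)))

end SinglePrincipalCurvature

end PseudoRiem

theorem theorem4p1_general {m : ℕ} [NeZero m]
    {M : Type*} [TopologicalSpace M] [PreconnectedSpace M]
    [ChartedSpace (PseudoRiem.Coord m) M] [IsManifold (𝓡 m) ∞ M]
    {N : Type*} [TopologicalSpace N]
    [ChartedSpace (PseudoRiem.Coord (m + 1)) N] [IsManifold (𝓡 (m + 1)) ∞ N]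
    {g : PseudoRiem.Metric (m + 1) N} {r : ℕ} {lam ε : ℝ}
    {x : M → N} (hx : PseudoRiem.IsNondegenerateImmersion m g x r)
    {ξ : ∀ p : M, TangentSpace (𝓡 (m + 1)) (x p)} (hε : ε = 1 ∨ ε = -1)
    (hξ : PseudoRiem.IsUnitNormal m g x ξ ε)
    (hR : PseudoRiem.IsCurvatureInvariant (m := m) g x ξ)
    (hproper : PseudoRiem.LaplacianEq m g x
      (PseudoRiem.meanCurvatureVector (m := m) g x ξ ε)
      (fun p => lam • PseudoRiem.meanCurvatureVector (m := m) g x ξ ε p))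
    (hcurv : ∀ p : M, ∃ μ : ℂ, PseudoRiem.principalCurvatures (m := m) g x ξ p = {μ}) :
    (ε * lam ≤ 0 → ∀ p : M, PseudoRiem.meanCurvature (m := m) g x ξ ε p = 0) ∧
    (0 < ε * lam →
      (∀ p : M, PseudoRiem.meanCurvature (m := m) g x ξ ε p = 0) ∨
      (∀ p : M, PseudoRiem.meanCurvature (m := m) g x ξ ε p ^ 2 = ε * lam / m)) := by
  have hvalues := PseudoRiem.meanCurvature_eq_zero_or_sq_eq hx hε hξ hR hproper hcurv
  have hcont := PseudoRiem.continuous_meanCurvature (ε := ε) hx hξ.contMDiff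
  set H : M → ℝ := PseudoRiem.meanCurvature (m := m) g x ξ ε
  refine ⟨fun hle p => (hvalues p).elim id fun hsq => ?_,
    fun _ => or_iff_not_imp_left.2 fun hne => ?_⟩
  · have hnonpos : H p ^ 2 ≤ 0 :=
      hsq.trans_le (div_nonpos_of_nonpos_of_nonneg hle m.cast_nonneg)
    exact sq_nonpos_iff _ |>.1 hnonpos
  · obtain ⟨p₀, hp₀⟩ := not_forall.1 hne
    have hmaps : Set.MapsTo (fun p => H p ^ 2) Set.univ {0, ε * lam / m} := fun p _ =>
      (hvalues p).imp_left sq_eq_zero_iff.2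
    intro p
    rw [← (hvalues p₀).resolve_left hp₀]
    exact isPreconnected_univ.constant_of_mapsTo (Set.toFinite _).isDiscrete
      (hcont.pow 2).continuousOn hmaps trivial trivial

theorem theorem4p1
    {M : Type*} [TopologicalSpace M] [ConnectedSpace M]
    [ChartedSpace (PseudoRiem.Coord 4) M] [IsManifold (𝓡 4) ∞ M]
    {N : Type*} [TopologicalSpace N]
    [ChartedSpace (PseudoRiem.Coord 5) N] [IsManifold (𝓡 5) ∞ N]
    (g : PseudoRiem.Metric 5 N) (s r : ℕ) (c lam ε : ℝ)
    (hN : PseudoRiem.IsSpaceForm g s c)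
    (x : M → N) (hx : PseudoRiem.IsNondegenerateImmersion 4 g x r)
    (ξ : ∀ p : M, TangentSpace (𝓡 5) (x p)) (hε : ε = 1 ∨ ε = -1)
    (hξ : PseudoRiem.IsUnitNormal 4 g x ξ ε)
    (hproper : PseudoRiem.LaplacianEq 4 g x
      (PseudoRiem.meanCurvatureVector (m := 4) g x ξ ε)
      (fun p => lam • PseudoRiem.meanCurvatureVector (m := 4) g x ξ ε p))
    (hcurv : ∀ p : M, ∃ μ : ℂ, PseudoRiem.principalCurvatures (m := 4) g x ξ p = {μ}) :
    (ε * lam ≤ 0 → ∀ p : M, PseudoRiem.meanCurvature (m := 4) g x ξ ε p = 0) ∧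
    (0 < ε * lam →
      (∀ p : M, PseudoRiem.meanCurvature (m := 4) g x ξ ε p = 0) ∨
      (∀ p : M, PseudoRiem.meanCurvature (m := 4) g x ξ ε p ^ 2 = ε * lam / 4)) := by
  exact_mod_cast theorem4p1_general hx hε hξ (hN.isCurvatureInvariant hx hξ hε) hproper hcurv
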